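/- Let $\mathbb N=\{0,1,2,\dots\}$. For $\theta=(r,d_1,a_1,b_1,d_2,a_2,b_2)$ with $r\in\mathbb N$, $y\in\mathbb N$ and $\ell\ge 0$ put $$g_\theta(y,\ell)=\begin{cases} d_1+a_1\ell+b_1y,& y\le r,\\ d_2+a_2\ell+b_2y,& y>r.\end{cases}$$ Let $\mathbf\Theta$ be the set of $(d_1,a_1,b_1,d_2,a_2,b_2)\in(0,\infty)^6$ with $a_1<1$, $b_1<1$, $a_2+b_2<1$, let $\mathcal D\subset\mathbf\Theta$ be compact with interior $\mathcal D^o$, let $r_*\in\mathbb N$, and let $\theta_0=(r_0,d_1,a_1,b_1,d_2,a_2,b_2)\in\{0,\dots,r_*\}\times\mathcal D^o$. Let $(Y_t)_{t\in\mathbb Z}$ be $\mathbb N$-valued random variables following the self-excited threshold Poisson autoregression with parameter $\theta_0$: with $\mathcal F_t=\sigma(Y_s,\,s\le t)$, the conditional law of $Y_t$ given $\mathcal F_{t-1}$ is Poisson with mean $\lambda_t$, where $\lambda_t=g_{\theta_0}(Y_{t-1},\lambda_{t-1})$ for all $t\in\mathbb Z$ (stationarity is not assumed). Fix an initial value $\tilde\lambda_1>0$,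 put $\tilde\lambda_1(\theta)=\tilde\lambda_1$ and $\tilde\lambda_t(\theta)=g_\theta(Y_{t-1},\tilde\lambda_{t-1}(\theta))$ for $t\ge 2$, and for each $n\ge 1$ let $\hat\theta=\hat\theta_n$ be any maximizer of the conditional log-likelihood $$\tilde\ell(\theta)=\sum_{t=1}^n\bigl(-\tilde\lambda_t(\theta)+Y_t\log\tilde\lambda_t(\theta)\bigr)$$ over $\theta\in\{0,\dots,r_*\}\times\mathcal D$, the threshold being estimated jointly with the other parameters. (i) Suppose that $\theta_0$ is nondegenerate, in the sense that $r_0\ge 1$ and that, if $a_1=a_2$, then $d_1+b_1r_0\ne d_2+b_2r_0$ and, in case $r_0<r_*$, also $d_1+b_1(r_0+1)\ne d_2+b_2(r_0+1)$. Then $\hat\theta_n$ is strongly consistent: almost surely $\hat\theta_n\to\theta_0$ as $n\to\infty$; in particular $\hat r_n=r_0$ for all sufficiently large $n$. (ii) Whether or not $\theta_0$ is nondegenerate, almost surely the distance from $\hat\theta_n$ to the set of those $\theta\in\{0,\dots,r_*\}\times\mathcal D$ with $g_\theta(y,\ell)=g_{\theta_0}(y,\ell)$ for all $y\in\mathbb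 N$, $\ell>0$ tends to $0$. -/

import Mathlib

open MeasureTheory ProbabilityTheory Filter Topology
open scoped NNReal

noncomputable section

namespace SETPAR

/-- The regression parameters `(d₁, a₁, b₁, d₂, a₂, b₂)`, as a vector of `ℝ⁶`. -/
abbrev Coef : Type := EuclideanSpace ℝ (Fin 6)

/-- The full parameter `θ = (r, (d₁, a₁, b₁, d₂, a₂, b₂))`, with `r` the integer threshold. The
topology is the product of the discrete topology of `ℕ` and the usual one of `ℝ⁶`. -/
abbrev Param : Type := ℕ × Coef

/-- Intercept of the lower regime. -/
def Param.d₁ (θ : Param) : ℝ := θ.2 0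
/-- Coefficient of the previous intensity in the lower regime. -/
def Param.a₁ (θ : Param) : ℝ := θ.2 1
/-- Coefficient of the previous count in the lower regime. -/
def Param.b₁ (θ : Param) : ℝ := θ.2 2
/-- Intercept of the upper regime. -/
def Param.d₂ (θ : Param) : ℝ := θ.2 3
/-- Coefficient of the previous intensity in the upper regime. -/
def Param.a₂ (θ : Param) : ℝ := θ.2 4
/-- Coefficient of the previous count in the upper regime. -/
def Param.b₂ (θ : Param) : ℝ := θ.2 5

/-- The set `Θ` of all vectors with strictly positive entries and
`a₁ < 1`, `b₁ < 1`, `a₂ + b₂ < 1`. -/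
def bigTheta : Set Coef :=
  {x | (∀ i, 0 < x i) ∧ x 1 < 1 ∧ x 2 < 1 ∧ x 4 + x 5 < 1}

/-- The parameter space `([0, r_*] ∩ ℕ) × D`. -/
def paramSpace (rstar : ℕ) (D : Set Coef) : Set Param :=
  {θ | θ.1 ≤ rstar ∧ θ.2 ∈ D}

/-- The threshold recursion: the intensity `λ_t` as a function of the previous count
`y = Y_{t-1}` and of the previous intensity `l = λ_{t-1}`. -/
def intensity (θ : Param) (y : ℕ) (l : ℝ) : ℝ :=
  if y ≤ θ.1 then Param.d₁ θ + Param.a₁ θ * l + Param.b₁ θ * (y : ℝ)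
  else Param.d₂ θ + Param.a₂ θ * l + Param.b₂ θ * (y : ℝ)

/-- The σ-algebra `F_t = σ(Y_s, s ≤ t)`. -/
abbrev past {Ω : Type*} (Y : ℤ → Ω → ℕ) (t : ℤ) : MeasurableSpace Ω :=
  ⨆ s : {s : ℤ // s ≤ t}, MeasurableSpace.comap (Y s) ⊤

/-- `Y = (Y_t)_{t ∈ ℤ}` follows the self-excited threshold Poisson autoregression with parameter
`θ` and intensity process `lam = (λ_t)_{t ∈ ℤ}`: the conditional law of `Y_t` given `F_{t-1}` is
Poisson with mean `λ_t`, and `λ_t` satisfies the threshold recursion. (The first property makes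
`λ_t` almost surely equal to an `F_{t-1}`-measurable variable; stationarity is not required.) -/
structure IsSETPAR {Ω : Type*} [MeasurableSpace Ω] (P : Measure Ω) (θ : Param)
    (Y : ℤ → Ω → ℕ) (lam : ℤ → Ω → ℝ≥0) : Prop where
  measurable : ∀ t, Measurable (Y t)
  condLaw : ∀ (t : ℤ) (A : Set ℕ),
    P[(Y t ⁻¹' A).indicator (fun _ => (1 : ℝ)) | past Y (t - 1)]
      =ᵐ[P] fun ω => (poissonMeasure (lam t ω)).real A
  recursion : ∀ t : ℤ, ∀ᵐ ω ∂P,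
    (lam t ω : ℝ) = intensity θ (Y (t - 1) ω) (lam (t - 1) ω)

/-- The sequence `λ̃_1, λ̃_2, …` computed by the recursion from the initial value `l₁ = λ̃_1` and
the observations `y 1, y 2, …`. (The value at index `0` is a dummy, never used.) -/
def tildeLam (l₁ : ℝ) (y : ℕ → ℕ) (θ : Param) : ℕ → ℝ
  | 0 => l₁
  | 1 => l₁
  | t + 2 => intensity θ (y (t + 1)) (tildeLam l₁ y θ (t + 1))

/-- The conditional log-likelihood (up to a constant) of the observations `y 1, …, y n`. -/
def logLik (l₁ : ℝ) (y : ℕ → ℕ) (n : ℕ) (θ : Param) : ℝ :=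
  ∑ t ∈ Finset.Icc 1 n,
    (-tildeLam l₁ y θ t + (y t : ℝ) * Real.log (tildeLam l₁ y θ t))

/-- `θhat` is a maximum likelihood estimate: it belongs to the parameter space `S` and maximizes
the conditional log-likelihood of `y 1, …, y n` over `S`, jointly in all seven parameters. -/
def IsMLE (S : Set Param) (l₁ : ℝ) (y : ℕ → ℕ) (n : ℕ) (θhat : Param) : Prop :=
  θhat ∈ S ∧ ∀ θ ∈ S, logLik l₁ y n θ ≤ logLik l₁ y n θhat

/-- The parameter determines the model among thresholds at most `rstar`: the lower regime contains
a positive count (otherwise `b₁` never enters the recursion), and the two regimes do not agree on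
`y = r`, nor on `y = r + 1` if `r + 1` is an admissible threshold (otherwise moving the threshold
by one does not change the recursion). This forces `(d₁, a₁, b₁) ≠ (d₂, a₂, b₂)`. -/
def Nondegenerate (rstar : ℕ) (θ : Param) : Prop :=
  1 ≤ θ.1 ∧
  (Param.a₁ θ = Param.a₂ θ →
    Param.d₁ θ + Param.b₁ θ * (θ.1 : ℝ) ≠ Param.d₂ θ + Param.b₂ θ * (θ.1 : ℝ) ∧
    (θ.1 < rstar →
      Param.d₁ θ + Param.b₁ θ * ((θ.1 : ℝ) + 1) ≠ Param.d₂ θ + Param.b₂ θ * ((θ.1 : ℝ) + 1)))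

/-- The parameters in `S` that define literally the same recursion as `θ₀`. -/
def sameModel (S : Set Param) (θ₀ : Param) : Set Param :=
  {θ ∈ S | ∀ (y : ℕ) (l : ℝ), 0 < l → intensity θ y l = intensity θ₀ y l}

end SETPAR

end

/-!
Write `T i` for the intensities computed from `θ` and the fixed starting value, `Λ i` for the true
ones and `N i` for the counts. Comparing the likelihoods of `θ` and `θ₀` bounds the average of
`(√(T i) - √(Λ i))²`, at a maximizer, by a term that vanishes because the recursion forgets its
starting value, plus the difference of the averages of `(N i - Λ i) * log (T i)` for `θ` and `θ₀`.
These averages tend to `0` by the strong law for `L²` martingale differences: the moments they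
require come from a drift condition for `exp (u * Λ i)`, and Lipschitz dependence on the parameter
makes the exceptional null set independent of it. So along any convergent subsequence of estimates
the limit `θ` has an average of `(√(T i) - √(Λ i))²` tending to `0`. Every pair `(y', y)` of
consecutive counts occurs with positive lower density at bounded intensities, so the affine maps
`l ↦ g_θ(y, l)` and `l ↦ g_{θ₀}(y, l)` agree at some `l` above any prescribed bound (take `y'`
large), hence everywhere. An unbounded initial intensity is handled by restricting the measure to
the events `Λ 0 ≤ K`.
-/

noncomputable section

namespace SETPAR

section Averages

/-- The average of the first `n` terms of a sequence (`0` for `n = 0`). -/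
def avg (x : ℕ → ℝ) (n : ℕ) : ℝ := (n : ℝ)⁻¹ * ∑ i ∈ Finset.range n, x i

/-- The root mean square of the first `n` terms of a sequence, a seminorm in the sequence. -/
def rms (x : ℕ → ℝ) (n : ℕ) : ℝ := √(avg (fun i => x i ^ 2) n)

variable {x y z : ℕ → ℝ} {n : ℕ}

lemma avg_mono (h : ∀ i, x i ≤ y i) (n : ℕ) : avg x n ≤ avg y n :=
  mul_le_mul_of_nonneg_left (Finset.sum_le_sum fun i _ => h i) (by positivity)

lemma avg_nonneg (h : ∀ i, 0 ≤ x i) (n : ℕ) : 0 ≤ avg x n :=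
  mul_nonneg (by positivity) (Finset.sum_nonneg fun i _ => h i)

lemma avg_add (x y : ℕ → ℝ) (n : ℕ) : avg (fun i => x i + y i) n = avg x n + avg y n := by
  simp only [avg, Finset.sum_add_distrib, mul_add]

lemma avg_sub (x y : ℕ → ℝ) (n : ℕ) : avg (fun i => x i - y i) n = avg x n - avg y n := by
  simp only [avg, Finset.sum_sub_distrib, mul_sub]

lemma avg_const (hn : n ≠ 0) (c : ℝ) : avg (fun _ => c) n = c := by
  simp [avg, hn]

lemma avg_const_mul (c : ℝ) (x : ℕ → ℝ) (n : ℕ) : avg (fun i => c * x i) n = c * avg x n := by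
  simp only [avg, ← Finset.mul_sum, mul_left_comm _ c]

lemma tendsto_avg {a : ℝ} (h : Tendsto x atTop (𝓝 a)) : Tendsto (avg x) atTop (𝓝 a) :=
  h.cesaro

lemma rms_nonneg (x : ℕ → ℝ) (n : ℕ) : 0 ≤ rms x n := Real.sqrt_nonneg _

lemma sq_rms (x : ℕ → ℝ) (n : ℕ) : rms x n ^ 2 = avg (fun i => x i ^ 2) n :=
  Real.sq_sqrt (avg_nonneg (fun _ => sq_nonneg _) n)

lemma rms_le_rms (h : ∀ i, |x i| ≤ |y i|) (n : ℕ) : rms x n ≤ rms y n :=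
  Real.sqrt_le_sqrt (avg_mono (fun i => sq_le_sq.2 (h i)) n)

lemma rms_const_mul (c : ℝ) (x : ℕ → ℝ) (n : ℕ) : rms (fun i => c * x i) n = |c| * rms x n := by
  simp only [rms, mul_pow, avg_const_mul]
  rw [Real.sqrt_mul (sq_nonneg c), Real.sqrt_sq_eq_abs]

lemma rms_const_le (c : ℝ) (n : ℕ) : rms (fun _ => c) n ≤ |c| := by
  rw [rms, avg, Finset.sum_const, Finset.card_range, nsmul_eq_mul, ← mul_assoc]
  exact Real.sqrt_le_left (abs_nonneg c) |>.2 <| by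
    rw [sq_abs]
    exact mul_le_of_le_one_left (sq_nonneg c) (inv_mul_le_one)

lemma rms_eq_norm (x : ℕ → ℝ) (n : ℕ) :
    rms x n = √(n : ℝ)⁻¹ * ‖WithLp.toLp 2 fun i : Fin n => x i‖ := by
  rw [rms, avg, Real.sqrt_mul (by positivity), EuclideanSpace.norm_eq, ← Fin.sum_univ_eq_sum_range]
  simp only [Real.norm_eq_abs, sq_abs]

lemma rms_add_le (x y : ℕ → ℝ) (n : ℕ) : rms (fun i => x i + y i) n ≤ rms x n + rms y n := by
  simp only [rms_eq_norm, ← mul_add]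
  exact mul_le_mul_of_nonneg_left (norm_add_le (WithLp.toLp 2 fun i : Fin n => x i)
    (WithLp.toLp 2 fun i : Fin n => y i)) (Real.sqrt_nonneg _)

lemma abs_avg_mul_le (x y : ℕ → ℝ) (n : ℕ) :
    |avg (fun i => x i * y i) n| ≤ rms x n * rms y n := by
  rw [rms, rms, ← Real.sqrt_mul (avg_nonneg (fun _ => sq_nonneg _) n)]
  refine Real.abs_le_sqrt ?_
  have cauchy_schwarz := Finset.sum_mul_sq_le_sq_mul_sq (Finset.range n) x y
  simp only [avg]
  calc ((n : ℝ)⁻¹ * ∑ i ∈ Finset.range n, x i * y i) ^ 2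
      = (n : ℝ)⁻¹ ^ 2 * (∑ i ∈ Finset.range n, x i * y i) ^ 2 := mul_pow _ _ _
    _ ≤ (n : ℝ)⁻¹ ^ 2 * ((∑ i ∈ Finset.range n, x i ^ 2) * ∑ i ∈ Finset.range n, y i ^ 2) := by
      gcongr
    _ = _ := by ring

lemma rms_le_of_succ_le (h : ∀ i, |y (i + 1)| ≤ |x i|) (n : ℕ) : rms y n ≤ |y 0| + rms x n := by
  refine (Real.sqrt_le_left (add_nonneg (abs_nonneg _) (rms_nonneg x n))).2 ?_
  have hsum : ∑ i ∈ Finset.range n, y i ^ 2 ≤ ∑ i ∈ Finset.range n, x i ^ 2 + y 0 ^ 2 := by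
    calc ∑ i ∈ Finset.range n, y i ^ 2
        ≤ ∑ i ∈ Finset.range (n + 1), y i ^ 2 := by
          rw [Finset.sum_range_succ]
          exact le_add_of_nonneg_right (sq_nonneg _)
      _ = ∑ i ∈ Finset.range n, y (i + 1) ^ 2 + y 0 ^ 2 := Finset.sum_range_succ' _ _
      _ ≤ _ := add_le_add_left (Finset.sum_le_sum fun i _ => sq_le_sq.2 (h i)) _
  calc avg (fun i => y i ^ 2) n
      ≤ (n : ℝ)⁻¹ * (∑ i ∈ Finset.range n, x i ^ 2 + y 0 ^ 2) := by unfold avg; gcongr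
    _ = (n : ℝ)⁻¹ * y 0 ^ 2 + rms x n ^ 2 := by rw [sq_rms, avg]; ring
    _ ≤ |y 0| ^ 2 + rms x n ^ 2 := by
      rw [sq_abs]
      gcongr
      exact mul_le_of_le_one_left (sq_nonneg _) (Nat.cast_inv_le_one n)
    _ ≤ (|y 0| + rms x n) ^ 2 := by
      nlinarith [mul_nonneg (abs_nonneg (y 0)) (rms_nonneg x n)]

lemma rms_le_of_contraction {ρ : ℝ} (hρ0 : 0 ≤ ρ) (hρ : ρ < 1)
    (hrec : ∀ i, |x (i + 1)| ≤ ρ * |x i| + |z i|) (n : ℕ) :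
    rms x n ≤ (|x 0| + rms z n) / (1 - ρ) := by
  have hself : rms x n ≤ |x 0| + (ρ * rms x n + rms z n) := by
    calc rms x n ≤ |x 0| + rms (fun i => ρ * |x i| + |z i|) n :=
          rms_le_of_succ_le (fun i => (hrec i).trans (le_abs_self _)) n
      _ ≤ |x 0| + (rms (fun i => ρ * |x i|) n + rms (fun i => |z i|) n) := by
          gcongr
          exact rms_add_le _ _ n
      _ ≤ |x 0| + (ρ * rms x n + rms z n) := by
          rw [rms_const_mul, abs_of_nonneg hρ0]
          gcongr <;> exact rms_le_rms (fun i => (abs_abs _).le) n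
  rw [le_div_iff₀ (sub_pos.2 hρ)]
  linarith

end Averages

section Recursion

/-- The slope `a₁` or `a₂` of the affine map `l ↦ intensity θ y l`. -/
def slope (θ : Param) (y : ℕ) : ℝ := if y ≤ θ.1 then θ.a₁ else θ.a₂

/-- The value at `0` of the affine map `l ↦ intensity θ y l`. -/
def intercept (θ : Param) (y : ℕ) : ℝ :=
  if y ≤ θ.1 then θ.d₁ + θ.b₁ * y else θ.d₂ + θ.b₂ * y

lemma intensity_eq (θ : Param) (y : ℕ) (l : ℝ) :
    intensity θ y l = intercept θ y + slope θ y * l := by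
  unfold intensity intercept slope
  split_ifs <;> ring

/-- Uniform bounds on the coefficients of a parameter: all of them lie in `[δ, B]` with `0 < δ`, and
both `a₁` and `a₂` are at most `ρ < 1`, which makes the recursion a contraction in the intensity. -/
structure CoefBounds (δ ρ B : ℝ) (θ : Param) : Prop where
  pos : 0 < δ
  lt_one : ρ < 1
  le_coef : ∀ i, δ ≤ θ.2 i
  coef_le : ∀ i, θ.2 i ≤ B
  a₁_le : θ.a₁ ≤ ρ
  a₂_le : θ.a₂ ≤ ρ

/-- The sequence `x` satisfies the threshold recursion with parameter `θ` and counts `N`. -/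
def IsTraj (θ : Param) (N : ℕ → ℕ) (x : ℕ → ℝ) : Prop := ∀ i, x (i + 1) = intensity θ (N i) (x i)

/-- The sequence computed by the threshold recursion with parameter `θ` from the initial value `l`
and the counts `N 0, N 1, …`. -/
def traj (θ : Param) (l : ℝ) (N : ℕ → ℕ) : ℕ → ℝ
  | 0 => l
  | i + 1 => intensity θ (N i) (traj θ l N i)

variable {δ ρ B l : ℝ} {θ θ' : Param} {N : ℕ → ℕ} {x x' : ℕ → ℝ}

lemma isTraj_traj (θ : Param) (l : ℝ) (N : ℕ → ℕ) : IsTraj θ N (traj θ l N) := fun _ => rfl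

namespace CoefBounds

lemma slope_pos (h : CoefBounds δ ρ B θ) (y : ℕ) : 0 < slope θ y := by
  unfold slope
  split_ifs
  exacts [h.pos.trans_le (h.le_coef 1), h.pos.trans_le (h.le_coef 4)]

lemma slope_le (h : CoefBounds δ ρ B θ) (y : ℕ) : slope θ y ≤ ρ := by
  unfold slope
  split_ifs
  exacts [h.a₁_le, h.a₂_le]

lemma rho_pos (h : CoefBounds δ ρ B θ) : 0 < ρ := (h.slope_pos 0).trans_le (h.slope_le 0)

lemma B_pos (h : CoefBounds δ ρ B θ) : 0 < B := h.pos.trans_le ((h.le_coef 0).trans (h.coef_le 0))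

lemma le_intercept (h : CoefBounds δ ρ B θ) (y : ℕ) : δ * (1 + y) ≤ intercept θ y := by
  rw [mul_one_add]
  unfold intercept
  split_ifs
  exacts [add_le_add (h.le_coef 0) (mul_le_mul_of_nonneg_right (h.le_coef 2) y.cast_nonneg),
    add_le_add (h.le_coef 3) (mul_le_mul_of_nonneg_right (h.le_coef 5) y.cast_nonneg)]

lemma intercept_le (h : CoefBounds δ ρ B θ) (y : ℕ) : intercept θ y ≤ B * (1 + y) := by
  rw [mul_one_add]
  unfold intercept
  split_ifs
  exacts [add_le_add (h.coef_le 0) (mul_le_mul_of_nonneg_right (h.coef_le 2) y.cast_nonneg),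
    add_le_add (h.coef_le 3) (mul_le_mul_of_nonneg_right (h.coef_le 5) y.cast_nonneg)]

lemma le_intensity (h : CoefBounds δ ρ B θ) (y : ℕ) (hl : 0 ≤ l) :
    δ * (1 + y) ≤ intensity θ y l := by
  rw [intensity_eq]
  exact (h.le_intercept y).trans (le_add_of_nonneg_right (mul_nonneg (h.slope_pos y).le hl))

lemma delta_le_intensity (h : CoefBounds δ ρ B θ) (y : ℕ) (hl : 0 ≤ l) : δ ≤ intensity θ y l :=
  (le_mul_of_one_le_right h.pos.le (by simp)).trans (h.le_intensity y hl)

lemma intensity_le (h : CoefBounds δ ρ B θ) (y : ℕ) (hl : 0 ≤ l) :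
    intensity θ y l ≤ ρ * l + B * (1 + y) := by
  rw [intensity_eq, add_comm]
  exact add_le_add (mul_le_mul_of_nonneg_right (h.slope_le y) hl) (h.intercept_le y)

lemma abs_intensity_sub_le (h : CoefBounds δ ρ B θ) (y : ℕ) (l l' : ℝ) :
    |intensity θ y l - intensity θ y l'| ≤ ρ * |l - l'| := by
  rw [intensity_eq, intensity_eq, add_sub_add_left_eq_sub, ← mul_sub, abs_mul,
    abs_of_pos (h.slope_pos y)]
  exact mul_le_mul_of_nonneg_right (h.slope_le y) (abs_nonneg _)

end CoefBounds

namespace Param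

lemma fst_eq_of_dist_lt_one (h : dist θ θ' < 1) : θ.1 = θ'.1 := by
  have hfst : dist θ.1 θ'.1 < 1 := (le_max_left _ _).trans_lt h
  rw [Nat.dist_eq] at hfst
  have hint : |(θ.1 : ℤ) - θ'.1| < 1 := mod_cast hfst
  rw [Int.abs_lt_one_iff] at hint
  lia

lemma abs_coef_sub_le_dist (θ θ' : Param) (i : Fin 6) : |θ.2 i - θ'.2 i| ≤ dist θ θ' :=
  calc |θ.2 i - θ'.2 i| ≤ ‖θ.2 - θ'.2‖ := PiLp.norm_apply_le (θ.2 - θ'.2) i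
    _ = dist θ.2 θ'.2 := (dist_eq_norm _ _).symm
    _ ≤ dist θ θ' := le_max_right _ _

lemma abs_slope_sub_le (hr : θ.1 = θ'.1) (y : ℕ) : |slope θ y - slope θ' y| ≤ dist θ θ' := by
  unfold slope
  rw [hr]
  split_ifs
  exacts [abs_coef_sub_le_dist θ θ' 1, abs_coef_sub_le_dist θ θ' 4]

lemma abs_intercept_sub_le (hr : θ.1 = θ'.1) (y : ℕ) :
    |intercept θ y - intercept θ' y| ≤ dist θ θ' * (1 + y) := by
  have affine (i j : Fin 6) :
      |θ.2 i + θ.2 j * y - (θ'.2 i + θ'.2 j * y)| ≤ dist θ θ' * (1 + y) := by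
    rw [mul_one_add, add_sub_add_comm, ← sub_mul]
    refine (abs_add_le _ _).trans (add_le_add (abs_coef_sub_le_dist θ θ' i) ?_)
    rw [abs_mul, Nat.abs_cast]
    exact mul_le_mul_of_nonneg_right (abs_coef_sub_le_dist θ θ' j) y.cast_nonneg
  unfold intercept
  rw [hr]
  split_ifs
  exacts [affine 0 2, affine 3 5]

lemma abs_intensity_sub_le (hr : θ.1 = θ'.1) (y : ℕ) (hl : 0 ≤ l) :
    |intensity θ y l - intensity θ' y l| ≤ dist θ θ' * (1 + l + y) := by
  rw [intensity_eq, intensity_eq, add_sub_add_comm, ← sub_mul]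
  calc |intercept θ y - intercept θ' y + (slope θ y - slope θ' y) * l|
      ≤ |intercept θ y - intercept θ' y| + |slope θ y - slope θ' y| * l := by
        refine (abs_add_le _ _).trans_eq ?_
        rw [abs_mul, abs_of_nonneg hl]
    _ ≤ dist θ θ' * (1 + y) + dist θ θ' * l := by
        gcongr
        exacts [abs_intercept_sub_le hr y, abs_slope_sub_le hr y]
    _ = dist θ θ' * (1 + l + y) := by ring

end Param

namespace IsTraj

lemma nonneg (hx : IsTraj θ N x) (h : CoefBounds δ ρ B θ) (h0 : 0 ≤ x 0) (i : ℕ) : 0 ≤ x i := by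
  induction i with
  | zero => exact h0
  | succ i ih => exact (hx i).symm ▸ h.pos.le.trans (h.delta_le_intensity (N i) ih)

lemma le (hx : IsTraj θ N x) (h : CoefBounds δ ρ B θ) {m : ℝ} (hmδ : m ≤ δ) (hm : m ≤ x 0)
    (h0 : 0 ≤ x 0) (i : ℕ) : m ≤ x i := by
  cases i with
  | zero => exact hm
  | succ i => exact (hx i).symm ▸ hmδ.trans (h.delta_le_intensity (N i) (hx.nonneg h h0 i))

lemma tendsto_sub (hx : IsTraj θ N x) (hx' : IsTraj θ N x') (h : CoefBounds δ ρ B θ) :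
    Tendsto (fun i => x i - x' i) atTop (𝓝 0) := by
  have geometric (i : ℕ) : |x i - x' i| ≤ ρ ^ i * |x 0 - x' 0| := by
    induction i with
    | zero => simp
    | succ i ih =>
      rw [hx i, hx' i, pow_succ', mul_assoc]
      exact (h.abs_intensity_sub_le _ _ _).trans (mul_le_mul_of_nonneg_left ih h.rho_pos.le)
  refine squeeze_zero_norm geometric ?_
  simpa using (tendsto_pow_atTop_nhds_zero_of_lt_one h.rho_pos.le h.lt_one).mul_const |x 0 - x' 0|

lemma rms_le (hx : IsTraj θ N x) (h : CoefBounds δ ρ B θ) (h0 : 0 ≤ x 0) (n : ℕ) :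
    rms x n ≤ (x 0 + B * (1 + rms (fun i => N i) n)) / (1 - ρ) := by
  have input : rms (fun i => B * (1 + (N i : ℝ))) n ≤ B * (1 + rms (fun i => N i) n) := by
    rw [rms_const_mul, abs_of_pos h.B_pos]
    gcongr
    · exact h.B_pos.le
    · exact (rms_add_le _ _ n).trans (add_le_add_left (by simpa using rms_const_le 1 n) _)
  have step (i : ℕ) : |x (i + 1)| ≤ ρ * |x i| + |B * (1 + (N i : ℝ))| := by
    rw [abs_of_nonneg (hx.nonneg h h0 i), abs_of_nonneg (hx.nonneg h h0 (i + 1)), hx i]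
    exact (h.intensity_le _ (hx.nonneg h h0 i)).trans (by gcongr; exact le_abs_self _)
  refine (rms_le_of_contraction h.rho_pos.le h.lt_one step n).trans ?_
  rw [abs_of_nonneg h0]
  gcongr
  exact (sub_pos.2 h.lt_one).le

lemma exists_rms_le (hx : IsTraj θ N x) (h : CoefBounds δ ρ B θ) (h0 : 0 ≤ x 0) {C : ℝ}
    (hN : ∀ n, rms (fun i => N i) n ≤ C) : ∃ C', ∀ n, rms x n ≤ C' := by
  refine ⟨(x 0 + B * (1 + C)) / (1 - ρ), fun n => (hx.rms_le h h0 n).trans ?_⟩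
  gcongr
  exacts [(sub_pos.2 h.lt_one).le, h.B_pos.le, hN n]

lemma rms_sub_le (hx : IsTraj θ N x) (hx' : IsTraj θ' N x') (h : CoefBounds δ ρ B θ)
    (h' : CoefBounds δ ρ B θ') (hr : θ.1 = θ'.1) (h0 : x 0 = x' 0) (h0' : 0 ≤ x' 0) (n : ℕ) :
    rms (fun i => x i - x' i) n
      ≤ dist θ θ' * (1 + rms x' n + rms (fun i => N i) n) / (1 - ρ) := by
  have input : rms (fun i => dist θ θ' * (1 + x' i + N i)) n
      ≤ dist θ θ' * (1 + rms x' n + rms (fun i => N i) n) := by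
    rw [rms_const_mul, abs_of_nonneg dist_nonneg]
    gcongr
    refine (rms_add_le _ _ n).trans (add_le_add_left ?_ _)
    exact (rms_add_le _ _ n).trans (add_le_add_left (by simpa using rms_const_le 1 n) _)
  have step (i : ℕ) : |x (i + 1) - x' (i + 1)|
      ≤ ρ * |x i - x' i| + |dist θ θ' * (1 + x' i + N i)| := by
    rw [hx i, hx' i]
    exact (abs_sub_le _ (intensity θ (N i) (x' i)) _).trans (add_le_add
      (h.abs_intensity_sub_le _ _ _)
      ((Param.abs_intensity_sub_le hr _ (hx'.nonneg h' h0' i)).trans (le_abs_self _)))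
  refine (rms_le_of_contraction h.rho_pos.le h.lt_one step n).trans ?_
  rw [h0, sub_self, abs_zero, zero_add]
  gcongr
  exact (sub_pos.2 h.lt_one).le

end IsTraj

end Recursion

section Likelihood

/-- The averaged martingale part of the log-likelihood at `θ`: the centred counts `N i - Λ i`,
weighted by the logarithms of the intensities computed with `θ` from the initial value `l`. -/
def noise (θ : Param) (l : ℝ) (N : ℕ → ℕ) (Λ : ℕ → ℝ) (n : ℕ) : ℝ :=
  avg (fun i => (N i - Λ i) * Real.log (traj θ l N i)) n

lemma add_sq_sqrt_sub_sqrt_le {a b : ℝ} (ha : 0 ≤ a) (hb : 0 < b) :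
    -b + a * Real.log b + (√b - √a) ^ 2 ≤ -a + a * Real.log a := by
  have hsb := Real.sq_sqrt hb.le
  rcases ha.eq_or_lt with rfl | ha
  · simp [hsb]
  have hsa := Real.sq_sqrt ha.le
  have hlog : Real.log b - Real.log a = 2 * Real.log (√b / √a) := by
    rw [Real.log_div (by positivity) (by positivity), Real.log_sqrt hb.le, Real.log_sqrt ha.le]
    ring
  have hle : Real.log (√b / √a) ≤ √b / √a - 1 := Real.log_le_sub_one_of_pos (by positivity)
  have hmul : a * (√b / √a) = √b * √a := by
    field_simp
    rw [hsa]
  nlinarith [mul_le_mul_of_nonneg_left hle ha.le]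

lemma le_add_sq_sub_div {a b : ℝ} (ha : 0 ≤ a) (hb : 0 < b) :
    -a + a * Real.log a ≤ -b + a * Real.log b + (b - a) ^ 2 / b := by
  rcases ha.eq_or_lt with rfl | ha
  · simp [sq, hb.ne']
  have hle : Real.log (a / b) ≤ a / b - 1 := Real.log_le_sub_one_of_pos (div_pos ha hb)
  rw [Real.log_div ha.ne' hb.ne'] at hle
  have hsplit : (b - a) ^ 2 / b = b - a + a * (a / b - 1) := by field_simp; ring
  nlinarith [mul_le_mul_of_nonneg_left hle ha.le]

lemma lipschitzOnWith_log_Ici {m : ℝ≥0} (hm : 0 < m) :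
    LipschitzOnWith m⁻¹ Real.log (Set.Ici m) := by
  refine (convex_Ici _).lipschitzOnWith_of_nnnorm_deriv_le (fun x hx => ?_) fun x hx => ?_
  · exact Real.differentiableAt_log ((NNReal.coe_pos.2 hm).trans_le hx).ne'
  · rw [Real.deriv_log, nnnorm_inv]
    exact inv_anti₀ hm (NNReal.coe_le_coe.1 (hx.trans (le_abs_self x)))

lemma lipschitzOnWith_sqrt_Ici {m : ℝ≥0} (hm : 0 < m) :
    LipschitzOnWith (NNReal.sqrt m)⁻¹ Real.sqrt (Set.Ici m) := by
  refine LipschitzOnWith.of_dist_le_mul fun a ha b hb => ?_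
  have hm' : (0 : ℝ) < √m := Real.sqrt_pos.2 (NNReal.coe_pos.2 hm)
  have hfactor : a - b = (√a + √b) * (√a - √b) := by
    rw [← sq_sub_sq, Real.sq_sqrt (m.2.trans ha), Real.sq_sqrt (m.2.trans hb)]
  have hsum : √m ≤ √a + √b := (Real.sqrt_le_sqrt ha).trans (le_add_of_nonneg_right (by positivity))
  rw [Real.dist_eq, Real.dist_eq, NNReal.coe_inv, Real.coe_sqrt, le_inv_mul_iff₀ hm', hfactor,
    abs_mul]
  exact mul_le_mul_of_nonneg_right (hsum.trans (le_abs_self _)) (abs_nonneg _)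

variable {δ ρ B l C C' : ℝ} {θ θ₀ : Param} {N : ℕ → ℕ} {Λ : ℕ → ℝ} {S : Set Param}

lemma tildeLam_succ (l : ℝ) (y : ℕ → ℕ) (θ : Param) (i : ℕ) :
    tildeLam l y θ (i + 1) = traj θ l (fun i => y (i + 1)) i := by
  induction i with
  | zero => rfl
  | succ i ih => rw [tildeLam, ih, traj]

lemma logLik_eq_sum_range (l : ℝ) (y : ℕ → ℕ) (n : ℕ) (θ : Param) :
    logLik l y n θ = ∑ i ∈ Finset.range n, (-traj θ l (fun i => y (i + 1)) i
      + (y (i + 1) : ℝ) * Real.log (traj θ l (fun i => y (i + 1)) i)) := by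
  rw [logLik, ← Finset.Ico_succ_right_eq_Icc, Finset.sum_Ico_eq_sum_range]
  simp only [add_comm 1, tildeLam_succ]
  rfl

/-- Comparing `θ` with `θ₀` in the likelihood replaces the true intensities `Λ` by the intensities
computed with `θ₀` from the wrong initial value: this costs the chi-square term. -/
lemma sq_rms_sqrt_sub_sqrt_le {y : ℕ → ℕ} {n : ℕ} (hN : ∀ i, N i = y (i + 1))
    (hle : logLik l y n θ₀ ≤ logLik l y n θ) (hθ : ∀ i, 0 < traj θ l N i)
    (hθ₀ : ∀ i, 0 < traj θ₀ l N i) (hΛ : ∀ i, 0 ≤ Λ i) :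
    rms (fun i => √(traj θ l N i) - √(Λ i)) n ^ 2
      ≤ avg (fun i => (traj θ₀ l N i - Λ i) ^ 2 / traj θ₀ l N i) n
        + noise θ l N Λ n - noise θ₀ l N Λ n := by
  obtain rfl : N = fun i => y (i + 1) := funext hN
  set N : ℕ → ℕ := fun i => y (i + 1)
  have hgain : 0 ≤ avg (fun i => (-traj θ l N i + N i * Real.log (traj θ l N i))
      - (-traj θ₀ l N i + N i * Real.log (traj θ₀ l N i))) n := by
    rw [avg, Finset.sum_sub_distrib, ← logLik_eq_sum_range, ← logLik_eq_sum_range]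
    exact mul_nonneg (by positivity) (sub_nonneg.2 hle)
  rw [sq_rms, noise, noise, ← avg_add, ← avg_sub]
  refine (le_add_of_nonneg_right hgain).trans ?_
  rw [← avg_add]
  refine avg_mono (fun i => ?_) n
  linarith [add_sq_sqrt_sub_sqrt_le (hΛ i) (hθ i), le_add_sq_sub_div (hΛ i) (hθ₀ i)]

lemma tendsto_avg_chi_sq (h : CoefBounds δ ρ B θ) (hl : 0 < l) (hΛ : IsTraj θ N Λ) :
    Tendsto (avg fun i => (traj θ l N i - Λ i) ^ 2 / traj θ l N i) atTop (𝓝 0) := by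
  have hm : 0 < min δ l := lt_min h.pos hl
  have hle := (isTraj_traj θ l N).le h (min_le_left δ l) (min_le_right δ l) hl.le
  have hlim : Tendsto (fun i => (traj θ l N i - Λ i) ^ 2 / min δ l) atTop (𝓝 0) := by
    simpa using (((isTraj_traj θ l N).tendsto_sub hΛ h).pow 2).div_const (min δ l)
  refine tendsto_avg (squeeze_zero (fun i => ?_) (fun i => ?_) hlim)
  · exact div_nonneg (sq_nonneg _) (hm.le.trans (hle i))
  · exact div_le_div_of_nonneg_left (sq_nonneg _) hm (hle i)

lemma exists_rms_traj_sub_le (hS : ∀ θ ∈ S, CoefBounds δ ρ B θ) (hl : 0 ≤ l)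
    (hN : ∀ n, rms (fun i => N i) n ≤ C) :
    ∃ K, ∀ θ ∈ S, ∀ θ' ∈ S, θ.1 = θ'.1 → ∀ n,
      rms (fun i => traj θ l N i - traj θ' l N i) n ≤ K * dist θ θ' := by
  refine ⟨(1 + (l + B * (1 + C)) / (1 - ρ) + C) / (1 - ρ), fun θ hθ θ' hθ' hr n => ?_⟩
  have hρ := (sub_pos.2 (hS θ hθ).lt_one).le
  have hB := (hS θ hθ).B_pos.le
  refine ((isTraj_traj θ l N).rms_sub_le (isTraj_traj θ' l N) (hS θ hθ) (hS θ' hθ') hr rfl hl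
    n).trans ?_
  rw [div_mul_eq_mul_div, mul_comm (dist θ θ')]
  gcongr
  · refine ((isTraj_traj θ' l N).rms_le (hS θ' hθ') hl n).trans ?_
    gcongr
    exacts [le_rfl, hN n]
  · exact hN n

lemma exists_rms_comp_traj_sub_le (hS : ∀ θ ∈ S, CoefBounds δ ρ B θ) (hl : 0 ≤ l)
    (hN : ∀ n, rms (fun i => N i) n ≤ C) {f : ℝ → ℝ} {c : ℝ≥0}
    (hf : LipschitzOnWith c f (Set.Ici (min δ l))) :
    ∃ K, ∀ θ ∈ S, ∀ θ' ∈ S, θ.1 = θ'.1 → ∀ n,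
      rms (fun i => f (traj θ l N i) - f (traj θ' l N i)) n ≤ K * dist θ θ' := by
  obtain ⟨K, hK⟩ := exists_rms_traj_sub_le hS hl hN
  refine ⟨c * K, fun θ hθ θ' hθ' hr n => ?_⟩
  have mem {θ} (hθ : θ ∈ S) (i : ℕ) : traj θ l N i ∈ Set.Ici (min δ l) :=
    (isTraj_traj θ l N).le (hS θ hθ) (min_le_left δ l) (min_le_right δ l) hl i
  have hpoint (i : ℕ) :
      |f (traj θ l N i) - f (traj θ' l N i)| ≤ |c * (traj θ l N i - traj θ' l N i)| := by
    rw [abs_mul, NNReal.abs_eq]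
    exact hf.dist_le_mul _ (mem hθ i) _ (mem hθ' i)
  refine (rms_le_rms hpoint n).trans ?_
  rw [rms_const_mul, NNReal.abs_eq, mul_assoc]
  exact mul_le_mul_of_nonneg_left (hK θ hθ θ' hθ' hr n) c.2

lemma exists_abs_noise_sub_le (hS : ∀ θ ∈ S, CoefBounds δ ρ B θ) (hδ : 0 < δ) (hl : 0 < l)
    (hN : ∀ n, rms (fun i => N i) n ≤ C) (hΛ : ∀ n, rms Λ n ≤ C') :
    ∃ K, ∀ θ ∈ S, ∀ θ' ∈ S, θ.1 = θ'.1 → ∀ n,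
      |noise θ l N Λ n - noise θ' l N Λ n| ≤ K * dist θ θ' := by
  obtain ⟨K, hK⟩ := exists_rms_comp_traj_sub_le hS hl.le hN
    (lipschitzOnWith_log_Ici (m := ⟨min δ l, (lt_min hδ hl).le⟩) (lt_min hδ hl))
  have hcentred (n : ℕ) : rms (fun i => N i - Λ i) n ≤ C + C' := by
    simp only [sub_eq_add_neg]
    refine (rms_add_le _ _ n).trans (add_le_add (hN n) ?_)
    exact (rms_le_rms (fun i => (abs_neg _).le) n).trans (hΛ n)
  refine ⟨(C + C') * K, fun θ hθ θ' hθ' hr n => ?_⟩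
  rw [noise, noise, ← avg_sub, mul_assoc]
  simp only [← mul_sub]
  exact (abs_avg_mul_le _ _ n).trans (mul_le_mul (hcentred n) (hK θ hθ θ' hθ' hr n)
    (rms_nonneg _ n) ((rms_nonneg _ n).trans (hcentred n)))

lemma Param.eventually_fst_eq {ι : Type*} {F : Filter ι} {u : ι → Param} (hu : Tendsto u F (𝓝 θ)) :
    ∀ᶠ k in F, (u k).1 = θ.1 :=
  (Metric.tendsto_nhds.1 hu 1 one_pos).mono fun _ => fst_eq_of_dist_lt_one

lemma tendsto_noise_of_dense (hS : ∀ θ ∈ S, CoefBounds δ ρ B θ) (hδ : 0 < δ) (hl : 0 < l)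
    (hN : ∀ n, rms (fun i => N i) n ≤ C) (hΛ : ∀ n, rms Λ n ≤ C') {Q : Set Param} (hQS : Q ⊆ S)
    (hSQ : S ⊆ closure Q) (hQ : ∀ θ ∈ Q, Tendsto (noise θ l N Λ) atTop (𝓝 0)) :
    ∀ θ ∈ S, Tendsto (noise θ l N Λ) atTop (𝓝 0) := by
  obtain ⟨K, hK⟩ := exists_abs_noise_sub_le hS hδ hl hN hΛ
  intro θ hθ
  obtain ⟨q, hqQ, hq⟩ := mem_closure_iff_seq_limit.1 (hSQ hθ)
  have huniform : TendstoUniformly (fun k => noise (q k) l N Λ) (noise θ l N Λ) atTop := by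
    have hdist : Tendsto (fun k => K * dist θ (q k)) atTop (𝓝 0) := by
      simpa [dist_comm θ] using (tendsto_iff_dist_tendsto_zero.1 hq).const_mul K
    rw [Metric.tendstoUniformly_iff]
    intro ε hε
    filter_upwards [hdist.eventually (gt_mem_nhds hε), Param.eventually_fst_eq hq] with k hk hr n
    exact (hK θ hθ (q k) (hQS (hqQ k)) hr.symm n).trans_lt hk
  exact huniform.tendsto_of_eventually_tendsto
    (.of_forall fun k => hQ _ (hqQ k)) tendsto_const_nhds

end Likelihood

section LowerDensity

/-- The set `A` of indices has positive lower density. -/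
def HasPosLowerDensity (A : Set ℕ) : Prop :=
  ∃ c > 0, ∀ᶠ n in atTop, c ≤ avg (A.indicator 1) n

variable {A : Set ℕ}

lemma HasPosLowerDensity.mono {A' : Set ℕ} (hA : HasPosLowerDensity A) (h : A ⊆ A') :
    HasPosLowerDensity A' := by
  obtain ⟨c, hc, hfreq⟩ := hA
  refine ⟨c, hc, hfreq.mono fun n hn => hn.trans (avg_mono (fun i => ?_) n)⟩
  exact Set.indicator_le_indicator_of_subset h (fun _ => zero_le_one) i

lemma indicator_image_succ_succ (A : Set ℕ) (i : ℕ) :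
    (Nat.succ '' A).indicator (1 : ℕ → ℝ) (i + 1) = A.indicator 1 i := by
  rw [← Nat.succ_eq_add_one, Set.indicator_image Nat.succ_injective]
  rfl

lemma avg_indicator_le_avg_indicator_image_succ (A : Set ℕ) (n : ℕ) :
    avg (A.indicator 1) n ≤ avg ((Nat.succ '' A).indicator 1) n + (n : ℝ)⁻¹ := by
  have hsum : ∑ i ∈ Finset.range n, A.indicator (1 : ℕ → ℝ) i
      + (Nat.succ '' A).indicator (1 : ℕ → ℝ) 0
      = ∑ i ∈ Finset.range (n + 1), (Nat.succ '' A).indicator (1 : ℕ → ℝ) i := by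
    simp only [Finset.sum_range_succ', indicator_image_succ_succ]
  have hle : ∑ i ∈ Finset.range n, A.indicator (1 : ℕ → ℝ) i
      ≤ ∑ i ∈ Finset.range n, (Nat.succ '' A).indicator (1 : ℕ → ℝ) i + 1 := by
    refine (le_add_of_nonneg_right (Set.indicator_nonneg (fun _ _ => zero_le_one) _)).trans
      (hsum.trans_le ?_)
    rw [Finset.sum_range_succ]
    exact add_le_add_right (Set.indicator_le_self' (fun _ _ => zero_le_one) n) _
  rw [avg, avg, ← mul_add_one]
  gcongr

lemma HasPosLowerDensity.image_succ (hA : HasPosLowerDensity A) :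
    HasPosLowerDensity (Nat.succ '' A) := by
  obtain ⟨c, hc, hfreq⟩ := hA
  refine ⟨c / 2, half_pos hc, ?_⟩
  filter_upwards [hfreq, tendsto_inv_atTop_nhds_zero_nat.eventually (gt_mem_nhds (half_pos hc))]
    with n hn hsmall
  linarith [avg_indicator_le_avg_indicator_image_succ A n]

lemma hasPosLowerDensity_setOf_le {x : ℕ → ℝ} {C K : ℝ} (hx : ∀ i, 0 ≤ x i)
    (hC : ∀ n, avg x n ≤ C) (hCK : C < K) : HasPosLowerDensity {i | x i ≤ K} := by
  have hC0 : 0 ≤ C := (avg_nonneg hx 0).trans (hC 0)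
  have hK : 0 < K := hC0.trans_lt hCK
  refine ⟨1 - C / K, sub_pos.2 ((div_lt_one hK).2 hCK), ?_⟩
  filter_upwards [eventually_ge_atTop 1] with n hn
  have hpoint (i : ℕ) : 1 - K⁻¹ * x i ≤ Set.indicator {i | x i ≤ K} 1 i := by
    by_cases hi : x i ≤ K
    · simpa [hi] using mul_nonneg (inv_nonneg.2 hK.le) (hx i)
    · simpa [hi] using (one_le_inv_mul₀ hK).2 (not_le.1 hi).le
  calc 1 - C / K ≤ 1 - K⁻¹ * avg x n := by
        rw [div_eq_inv_mul]
        gcongr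
        exact hC n
    _ = avg (fun i => 1 - K⁻¹ * x i) n := by
        rw [avg_sub, avg_const_mul, avg_const (Nat.pos_iff_ne_zero.1 hn)]
    _ ≤ _ := avg_mono hpoint n

lemma avg_le_of_succ_le {x y : ℕ → ℝ} (hx : ∀ i, 0 ≤ x i) (h0 : y 0 ≤ 0)
    (h : ∀ i, y (i + 1) ≤ x i + x (i + 1)) (n : ℕ) : avg y n ≤ 2 * avg x n := by
  have hsum (n : ℕ) :
      ∑ i ∈ Finset.range (n + 1), y i + x n ≤ 2 * ∑ i ∈ Finset.range (n + 1), x i := by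
    induction n with
    | zero => simp; linarith [hx 0]
    | succ n ih =>
      rw [Finset.sum_range_succ, Finset.sum_range_succ x]
      linarith [h n]
  cases n with
  | zero => simp [avg]
  | succ n =>
    rw [avg, avg, mul_left_comm]
    gcongr
    linarith [hsum n, hx n]

lemma exists_seq_tendsto_of_hasPosLowerDensity {d : ℕ → ℝ} (hd : ∀ i, 0 ≤ d i) {φ : ℕ → ℕ}
    (hφ : Tendsto φ atTop atTop) (havg : Tendsto (fun k => avg d (φ k)) atTop (𝓝 0))
    (hA : HasPosLowerDensity A) :
    ∃ j : ℕ → ℕ, (∀ k, j k ∈ A) ∧ Tendsto (fun k => d (j k)) atTop (𝓝 0) ∧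
      Tendsto (fun k => d (j k + 1)) atTop (𝓝 0) := by
  have small {ε : ℝ} (hε : 0 < ε) : ∃ i ∈ A, d i + d (i + 1) < ε := by
    by_contra! hlarge
    obtain ⟨c, hc, hfreq⟩ := hA.image_succ
    have hsucc (i : ℕ) :
        ε * (Nat.succ '' A).indicator (1 : ℕ → ℝ) (i + 1) ≤ d i + d (i + 1) := by
      rw [indicator_image_succ_succ]
      by_cases hi : i ∈ A
      · simpa [hi] using hlarge i hi
      · simpa [hi] using add_nonneg (hd i) (hd (i + 1))
    have hle (n : ℕ) := avg_le_of_succ_le hd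
      (y := fun i => ε * (Nat.succ '' A).indicator (1 : ℕ → ℝ) i) (by simp) hsucc n
    have hlim : Tendsto (fun k => 2 * avg d (φ k)) atTop (𝓝 0) := by simpa using havg.const_mul 2
    obtain ⟨k, hk, hck⟩ := ((hlim.eventually (gt_mem_nhds (mul_pos hε hc))).and
      (hφ.eventually hfreq)).exists
    have := hle (φ k)
    rw [avg_const_mul] at this
    exact hk.not_ge ((mul_le_mul_of_nonneg_left hck hε.le).trans this)
  choose j hjA hj using fun k : ℕ => small (Nat.one_div_pos_of_nat (α := ℝ) (n := k))
  have hsum : Tendsto (fun k => d (j k) + d (j k + 1)) atTop (𝓝 0) :=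
    squeeze_zero (fun k => add_nonneg (hd _) (hd _)) (fun k => (hj k).le)
      tendsto_one_div_add_atTop_nhds_zero_nat
  exact ⟨j, hjA, squeeze_zero (fun k => hd _) (fun k => le_add_of_nonneg_right (hd _)) hsum,
    squeeze_zero (fun k => hd _) (fun k => le_add_of_nonneg_left (hd _)) hsum⟩

end LowerDensity

section Identification

lemma tendsto_of_tendsto_sqrt_sub_sqrt {ι : Type*} {F : Filter ι} {a b : ι → ℝ} {L : ℝ}
    (hb : ∀ k, 0 ≤ b k) (ha : Tendsto a F (𝓝 L)) (hL : 0 ≤ L)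
    (hab : Tendsto (fun k => √(b k) - √(a k)) F (𝓝 0)) : Tendsto b F (𝓝 L) := by
  have hsqrt : Tendsto (fun k => √(b k)) F (𝓝 √L) := by
    simpa using hab.add ha.sqrt
  simpa only [Real.sq_sqrt (hb _), Real.sq_sqrt hL] using hsqrt.pow 2

lemma tendsto_infDist_of_forall_subseq {X : Type*} [PseudoMetricSpace X] {S T : Set X}
    (hS : IsCompact S) {u : ℕ → X} (hu : ∀ᶠ n in atTop, u n ∈ S)
    (hT : ∀ φ : ℕ → ℕ, Tendsto φ atTop atTop → ∀ a ∈ S, Tendsto (u ∘ φ) atTop (𝓝 a) → a ∈ T) :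
    Tendsto (fun n => Metric.infDist (u n) T) atTop (𝓝 0) := by
  refine tendsto_of_subseq_tendsto fun ψ hψ => ?_
  obtain ⟨a, haS, χ, hχ, hlim⟩ := hS.tendsto_subseq' (hψ.eventually hu).frequently
  refine ⟨χ, ?_⟩
  rw [← Metric.infDist_zero_of_mem (hT _ (hψ.comp hχ.tendsto_atTop) a haS hlim)]
  exact ((Metric.continuous_infDist_pt T).tendsto a).comp hlim

variable {δ ρ B l l' : ℝ} {θ θ₀ : Param} {N : ℕ → ℕ} {Λ T : ℕ → ℝ} {S : Set Param} {y : ℕ}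

lemma continuous_intensity (θ : Param) (y : ℕ) : Continuous (intensity θ y) := by
  simp only [funext (intensity_eq θ y)]
  fun_prop

lemma exists_intensity_eq (hT : IsTraj θ N T) (hΛ : IsTraj θ₀ N Λ) (hT0 : ∀ i, 0 ≤ T i)
    (hΛ0 : ∀ i, 0 ≤ Λ i) {I : Set ℝ} (hI : IsCompact I) {j : ℕ → ℕ} (hj : ∀ k, N (j k) = y)
    (hjI : ∀ k, Λ (j k) ∈ I) (hd : Tendsto (fun k => √(T (j k)) - √(Λ (j k))) atTop (𝓝 0))
    (hd' : Tendsto (fun k => √(T (j k + 1)) - √(Λ (j k + 1))) atTop (𝓝 0)) :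
    ∃ l ∈ I, intensity θ y l = intensity θ₀ y l := by
  obtain ⟨l, hlI, χ, hχ, hΛl⟩ := hI.tendsto_subseq hjI
  have hTl : Tendsto (fun k => T (j (χ k))) atTop (𝓝 l) :=
    tendsto_of_tendsto_sqrt_sub_sqrt (fun k => hT0 _) hΛl (ge_of_tendsto' hΛl fun k => hΛ0 _)
      (hd.comp hχ.tendsto_atTop)
  have hΛnext : Tendsto (fun k => Λ (j (χ k) + 1)) atTop (𝓝 (intensity θ₀ y l)) := by
    simp only [hΛ _, hj]
    exact ((continuous_intensity θ₀ y).tendsto l).comp hΛl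
  have hTnext : Tendsto (fun k => T (j (χ k) + 1)) atTop (𝓝 (intensity θ y l)) := by
    simp only [hT _, hj]
    exact ((continuous_intensity θ y).tendsto l).comp hTl
  refine ⟨l, hlI, tendsto_nhds_unique hTnext ?_⟩
  exact tendsto_of_tendsto_sqrt_sub_sqrt (fun k => hT0 _) hΛnext
    (ge_of_tendsto' hΛnext fun k => hΛ0 _) (hd'.comp hχ.tendsto_atTop)

lemma slope_eq_and_intercept_eq (hll' : l ≠ l') (h : intensity θ y l = intensity θ₀ y l)
    (h' : intensity θ y l' = intensity θ₀ y l') :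
    slope θ y = slope θ₀ y ∧ intercept θ y = intercept θ₀ y := by
  simp only [intensity_eq] at h h'
  have hslope : slope θ y = slope θ₀ y := mul_right_cancel₀ (sub_ne_zero.2 hll') (by linarith)
  rw [hslope] at h
  exact ⟨hslope, add_right_cancel h⟩

/-- The properties of a sequence of counts `N` and of its intensities `Λ` under the parameter `θ₀`
from which the consistency of maximum likelihood over `S` follows, and which hold almost surely. -/
structure IsTypicalPath (S : Set Param) (l : ℝ) (θ₀ : Param) (N : ℕ → ℕ) (Λ : ℕ → ℝ) : Prop where
  isTraj : IsTraj θ₀ N Λ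
  nonneg_zero : 0 ≤ Λ 0
  exists_rms_le : ∃ C, ∀ n, rms (fun i => N i) n ≤ C
  tendsto_noise : ∀ θ ∈ S, Tendsto (noise θ l N Λ) atTop (𝓝 0)
  pattern : ∀ y' y : ℕ, ∃ K,
    HasPosLowerDensity (Nat.succ '' {i | Λ i ≤ K ∧ N i = y'} ∩ {j | N j = y})

namespace IsTypicalPath

lemma exists_intensity_eq_mem_Icc (hp : IsTypicalPath S l θ₀ N Λ) (h : CoefBounds δ ρ B θ)
    (h₀ : CoefBounds δ ρ B θ₀) (hl : 0 ≤ l) {φ : ℕ → ℕ} (hφ : Tendsto φ atTop atTop)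
    (hclose : Tendsto (fun k => rms (fun i => √(traj θ l N i) - √(Λ i)) (φ k)) atTop (𝓝 0))
    (y' y : ℕ) :
    ∃ hi, ∃ l ∈ Set.Icc (δ * (1 + y')) hi, intensity θ y l = intensity θ₀ y l := by
  obtain ⟨K, hK⟩ := hp.pattern y' y
  have hΛ := hp.isTraj.nonneg h₀ hp.nonneg_zero
  have hmem {i : ℕ} (hi : i ∈ Nat.succ '' {i | Λ i ≤ K ∧ N i = y'} ∩ {j | N j = y}) :
      Λ i ∈ Set.Icc (δ * (1 + y')) (ρ * K + B * (1 + y')) := by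
    obtain ⟨⟨i, ⟨hΛi, rfl⟩, rfl⟩, -⟩ := hi
    rw [Nat.succ_eq_add_one, hp.isTraj i]
    refine ⟨h₀.le_intensity _ (hΛ i), (h₀.intensity_le _ (hΛ i)).trans ?_⟩
    gcongr
    exact h₀.rho_pos.le
  have havg : Tendsto (fun k => avg (fun i => (√(traj θ l N i) - √(Λ i)) ^ 2) (φ k)) atTop
      (𝓝 0) := by
    simpa [sq_rms] using hclose.pow 2
  obtain ⟨j, hj, hd, hd'⟩ :=
    exists_seq_tendsto_of_hasPosLowerDensity (fun i => sq_nonneg _) hφ havg hK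
  have sqrt_sq {x : ℕ → ℝ} (hx : Tendsto (fun k => x k ^ 2) atTop (𝓝 0)) :
      Tendsto x atTop (𝓝 0) :=
    (tendsto_zero_iff_abs_tendsto_zero x).2 (by
      simpa [Real.sqrt_sq_eq_abs, Function.comp_def] using hx.sqrt)
  exact ⟨_, exists_intensity_eq (isTraj_traj θ l N) hp.isTraj ((isTraj_traj θ l N).nonneg h hl) hΛ
    isCompact_Icc (fun k => (hj k).2) (fun k => hmem (hj k)) (sqrt_sq hd) (sqrt_sq hd')⟩

/-- The intensity following a large count is large, so that patterns with different first counts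
give two solutions of `intensity θ y l = intensity θ₀ y l`; both sides are affine in `l`. -/
lemma intensity_eq (hp : IsTypicalPath S l θ₀ N Λ) (h : CoefBounds δ ρ B θ)
    (h₀ : CoefBounds δ ρ B θ₀) (hl : 0 ≤ l) {φ : ℕ → ℕ} (hφ : Tendsto φ atTop atTop)
    (hclose : Tendsto (fun k => rms (fun i => √(traj θ l N i) - √(Λ i)) (φ k)) atTop (𝓝 0))
    (y : ℕ) (x : ℝ) : intensity θ y x = intensity θ₀ y x := by
  obtain ⟨hi, l₁, hl₁, heq₁⟩ := hp.exists_intensity_eq_mem_Icc h h₀ hl hφ hclose 0 y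
  obtain ⟨y', hy'⟩ := exists_nat_gt (hi / δ)
  obtain ⟨_, l₂, hl₂, heq₂⟩ := hp.exists_intensity_eq_mem_Icc h h₀ hl hφ hclose y' y
  have hlt : l₁ < l₂ :=
    calc l₁ ≤ hi := hl₁.2
      _ < y' * δ := (div_lt_iff₀ h.pos).1 hy'
      _ ≤ δ * (1 + y') := by linarith [h.pos]
      _ ≤ l₂ := hl₂.1
  obtain ⟨hslope, hintercept⟩ := slope_eq_and_intercept_eq hlt.ne heq₁ heq₂
  rw [SETPAR.intensity_eq, SETPAR.intensity_eq, hslope, hintercept]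

lemma tendsto_rms_sqrt_sub_sqrt (hp : IsTypicalPath S l θ₀ N Λ)
    (hS : ∀ θ ∈ S, CoefBounds δ ρ B θ) (hθ₀ : θ₀ ∈ S) (hl : 0 < l) {Y : ℕ → ℕ}
    (hY : ∀ i, N i = Y (i + 1)) {φ : ℕ → ℕ} (hφ : Tendsto φ atTop atTop) {u : ℕ → Param}
    (hu : ∀ᶠ k in atTop, IsMLE S l Y (φ k) (u k)) (hθ : θ ∈ S) (hlim : Tendsto u atTop (𝓝 θ)) :
    Tendsto (fun k => rms (fun i => √(traj θ l N i) - √(Λ i)) (φ k)) atTop (𝓝 0) := by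
  have hδ := (hS θ₀ hθ₀).pos
  have hm : 0 < min δ l := lt_min hδ hl
  have hpos {θ} (hθ : θ ∈ S) (i : ℕ) : 0 < traj θ l N i :=
    hm.trans_le ((isTraj_traj θ l N).le (hS θ hθ) (min_le_left δ l) (min_le_right δ l) hl.le i)
  have hΛ := hp.isTraj.nonneg (hS θ₀ hθ₀) hp.nonneg_zero
  obtain ⟨C, hC⟩ := hp.exists_rms_le
  obtain ⟨C', hC'⟩ := hp.isTraj.exists_rms_le (hS θ₀ hθ₀) hp.nonneg_zero hC
  obtain ⟨K, hK⟩ := exists_abs_noise_sub_le hS hδ hl hC hC'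
  obtain ⟨K', hK'⟩ := exists_rms_comp_traj_sub_le hS hl.le hC
    (lipschitzOnWith_sqrt_Ici (m := ⟨min δ l, hm.le⟩) hm)
  have hdist := tendsto_iff_dist_tendsto_zero.1 hlim
  refine squeeze_zero' (.of_forall fun k => rms_nonneg _ _) (g := fun k => K' * dist (u k) θ
    + √(avg (fun i => (traj θ₀ l N i - Λ i) ^ 2 / traj θ₀ l N i) (φ k)
      + (noise θ l N Λ (φ k) + K * dist (u k) θ) - noise θ₀ l N Λ (φ k))) ?_ ?_
  · filter_upwards [hu, Param.eventually_fst_eq hlim] with k hk hr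
    have htri := rms_add_le (fun i => √(traj θ l N i) - √(traj (u k) l N i))
      (fun i => √(traj (u k) l N i) - √(Λ i)) (φ k)
    simp only [sub_add_sub_cancel] at htri
    refine htri.trans (add_le_add ?_ (Real.le_sqrt_of_sq_le ?_))
    · rw [dist_comm]
      exact hK' θ hθ (u k) hk.1 hr.symm _
    · refine (sq_rms_sqrt_sub_sqrt_le hY (hk.2 θ₀ hθ₀) (hpos hk.1) (hpos hθ₀) hΛ).trans ?_
      linarith [le_of_abs_le (hK (u k) hk.1 θ hθ hr (φ k))]
  · simpa using (hdist.const_mul K').add (((((tendsto_avg_chi_sq (hS θ₀ hθ₀) hl hp.isTraj).comp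
      hφ).add (((hp.tendsto_noise θ hθ).comp hφ).add (hdist.const_mul K))).sub
      ((hp.tendsto_noise θ₀ hθ₀).comp hφ)).sqrt)

theorem tendsto_infDist_sameModel (hp : IsTypicalPath S l θ₀ N Λ)
    (hScpt : IsCompact S) (hS : ∀ θ ∈ S, CoefBounds δ ρ B θ) (hθ₀ : θ₀ ∈ S) (hl : 0 < l)
    {Y : ℕ → ℕ} (hY : ∀ i, N i = Y (i + 1)) {θhat : ℕ → Param}
    (hhat : ∀ᶠ n in atTop, IsMLE S l Y n (θhat n)) :
    Tendsto (fun n => Metric.infDist (θhat n) (sameModel S θ₀)) atTop (𝓝 0) := by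
  refine tendsto_infDist_of_forall_subseq hScpt (hhat.mono fun _ hn => hn.1)
    fun φ hφ θ hθ hlim => ⟨hθ, fun y x _ => ?_⟩
  exact hp.intensity_eq (hS θ hθ) (hS θ₀ hθ₀) hl.le hφ
    (hp.tendsto_rms_sqrt_sub_sqrt hS hθ₀ hl hY hφ (hφ.eventually hhat) hθ hlim) y x

end IsTypicalPath

end Identification

section Nondegenerate

variable {θ θ₀ : Param} {rstar : ℕ}

lemma slope_of_le {y : ℕ} (h : y ≤ θ.1) : slope θ y = θ.a₁ := if_pos h

lemma slope_of_lt {y : ℕ} (h : θ.1 < y) : slope θ y = θ.a₂ := if_neg h.not_ge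

lemma intercept_of_le {y : ℕ} (h : y ≤ θ.1) : intercept θ y = θ.d₁ + θ.b₁ * y := if_pos h

lemma intercept_of_lt {y : ℕ} (h : θ.1 < y) : intercept θ y = θ.d₂ + θ.b₂ * y := if_neg h.not_ge

lemma upper_eq_of_slope_eq_of_intercept_eq (hslope : ∀ y, slope θ y = slope θ₀ y)
    (hintercept : ∀ y, intercept θ y = intercept θ₀ y) :
    θ.d₂ = θ₀.d₂ ∧ θ.a₂ = θ₀.a₂ ∧ θ.b₂ = θ₀.b₂ := by
  have slope_eq := hslope (θ.1 + θ₀.1 + 1)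
  have intercept_eq := hintercept (θ.1 + θ₀.1 + 1)
  have intercept_eq' := hintercept (θ.1 + θ₀.1 + 2)
  rw [slope_of_lt (by lia), slope_of_lt (by lia)] at slope_eq
  rw [intercept_of_lt (by lia), intercept_of_lt (by lia)] at intercept_eq intercept_eq'
  push_cast at intercept_eq intercept_eq'
  have hb : θ.b₂ = θ₀.b₂ := by linarith
  rw [hb] at intercept_eq
  exact ⟨add_right_cancel intercept_eq, slope_eq, hb⟩

lemma lower_eq_of_slope_eq_of_intercept_eq (h : 1 ≤ θ.1) (h₀ : 1 ≤ θ₀.1)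
    (hslope : ∀ y, slope θ y = slope θ₀ y) (hintercept : ∀ y, intercept θ y = intercept θ₀ y) :
    θ.d₁ = θ₀.d₁ ∧ θ.a₁ = θ₀.a₁ ∧ θ.b₁ = θ₀.b₁ := by
  have slope_eq := hslope 0
  have intercept_eq := hintercept 0
  have intercept_eq' := hintercept 1
  rw [slope_of_le (Nat.zero_le _), slope_of_le (Nat.zero_le _)] at slope_eq
  rw [intercept_of_le (Nat.zero_le _), intercept_of_le (Nat.zero_le _)] at intercept_eq
  rw [intercept_of_le h, intercept_of_le h₀] at intercept_eq'
  simp only [Nat.cast_zero, mul_zero, add_zero, Nat.cast_one, mul_one] at intercept_eq intercept_eq'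
  rw [intercept_eq] at intercept_eq'
  exact ⟨intercept_eq, slope_eq, add_left_cancel intercept_eq'⟩

lemma Nondegenerate.eq_of_slope_eq_of_intercept_eq (hnd : Nondegenerate rstar θ₀)
    (hr : θ.1 ≤ rstar) (hslope : ∀ y, slope θ y = slope θ₀ y)
    (hintercept : ∀ y, intercept θ y = intercept θ₀ y) : θ = θ₀ := by
  obtain ⟨hr₀, hregimes⟩ := hnd
  obtain ⟨hd₂, ha₂, hb₂⟩ := upper_eq_of_slope_eq_of_intercept_eq hslope hintercept
  have hge : θ₀.1 ≤ θ.1 := by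
    by_contra! hlt
    have slope_eq := hslope θ₀.1
    have intercept_eq := hintercept θ₀.1
    rw [slope_of_lt hlt, slope_of_le le_rfl, ha₂] at slope_eq
    rw [intercept_of_lt hlt, intercept_of_le le_rfl, hd₂, hb₂] at intercept_eq
    exact (hregimes slope_eq.symm).1 intercept_eq.symm
  obtain ⟨hd₁, ha₁, hb₁⟩ :=
    lower_eq_of_slope_eq_of_intercept_eq (hr₀.trans hge) hr₀ hslope hintercept
  have hle : θ.1 ≤ θ₀.1 := by
    by_contra! hlt
    have slope_eq := hslope (θ₀.1 + 1)
    have intercept_eq := hintercept (θ₀.1 + 1)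
    rw [slope_of_le hlt, slope_of_lt (Nat.lt_succ_self _), ha₁] at slope_eq
    rw [intercept_of_le hlt, intercept_of_lt (Nat.lt_succ_self _), hd₁, hb₁,
      Nat.cast_add_one] at intercept_eq
    exact (hregimes slope_eq).2 (hlt.trans_le hr) intercept_eq
  refine Prod.ext (hle.antisymm hge) (PiLp.ext fun i => ?_)
  fin_cases i
  exacts [hd₁, ha₁, hb₁, hd₂, ha₂, hb₂]

theorem Nondegenerate.sameModel_eq_singleton {D : Set Coef} (hnd : Nondegenerate rstar θ₀)
    (hθ₀ : θ₀ ∈ paramSpace rstar D) : sameModel (paramSpace rstar D) θ₀ = {θ₀} := by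
  refine Set.Subset.antisymm (fun θ ⟨hθ, h⟩ => ?_)
    (Set.singleton_subset_iff.2 ⟨hθ₀, fun _ _ _ => rfl⟩)
  have affine (y : ℕ) :=
    slope_eq_and_intercept_eq (one_lt_two (α := ℝ)).ne (h y 1 one_pos) (h y 2 two_pos)
  exact hnd.eq_of_slope_eq_of_intercept_eq hθ.1 (fun y => (affine y).1) fun y => (affine y).2

end Nondegenerate

section LawOfLargeNumbers

open scoped ENNReal

lemma tendsto_avg_of_tendsto_sum_div {x : ℕ → ℝ} {a : ℝ}
    (h : Tendsto (fun n => ∑ i ∈ Finset.range n, ((i : ℝ) + 1)⁻¹ * x i) atTop (𝓝 a)) :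
    Tendsto (avg x) atTop (𝓝 0) := by
  set s : ℕ → ℝ := fun n => ∑ i ∈ Finset.range n, ((i : ℝ) + 1)⁻¹ * x i
  have sum_by_parts (n : ℕ) :
      ∑ i ∈ Finset.range n, x i = n * s n - ∑ i ∈ Finset.range n, s i := by
    induction n with
    | zero => simp
    | succ n ih =>
      have hsucc : s (n + 1) = s n + ((n : ℝ) + 1)⁻¹ * x n := Finset.sum_range_succ _ _
      rw [Finset.sum_range_succ, Finset.sum_range_succ, ih, hsucc]
      push_cast
      field_simp
      ring
  have hlim := h.sub (tendsto_avg h)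
  rw [sub_self] at hlim
  refine hlim.congr' ?_
  filter_upwards [eventually_ne_atTop 0] with n hn
  rw [avg, avg, sum_by_parts n]
  field_simp

variable {Ω : Type*} {m0 : MeasurableSpace Ω} {μ : Measure Ω} {ℱ : Filtration ℕ m0}
  {X U : ℕ → Ω → ℝ} {p : ℝ≥0∞}

/-- A sequence of random variables that is bounded in `L^p`. -/
structure LpBounded (X : ℕ → Ω → ℝ) (p : ℝ≥0∞) (μ : Measure Ω) : Prop where
  aestronglyMeasurable : ∀ i, AEStronglyMeasurable (X i) μ
  exists_eLpNorm_le : ∃ C : ℝ≥0, ∀ i, eLpNorm (X i) p μ ≤ C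

/-- Square-integrable martingale differences, with `X i` the increment between the times `i` and
`i + 1` of the filtration. -/
structure IsL2MartingaleDiff (ℱ : Filtration ℕ m0) (μ : Measure Ω) (X : ℕ → Ω → ℝ) : Prop where
  stronglyMeasurable : ∀ i, StronglyMeasurable[ℱ (i + 1)] (X i)
  memLp : ∀ i, MemLp (X i) 2 μ
  condExp_eq_zero : ∀ i, μ[X i | ℱ i] =ᵐ[μ] 0

namespace LpBounded

lemma memLp (h : LpBounded X p μ) (i : ℕ) : MemLp (X i) p μ :=
  ⟨h.aestronglyMeasurable i, (h.exists_eLpNorm_le.choose_spec i).trans_lt ENNReal.coe_lt_top⟩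

lemma sub_condExp (h : LpBounded X p μ) (hp : 1 ≤ p) :
    LpBounded (fun i => X i - μ[X i | ℱ i]) p μ := by
  obtain ⟨C, hC⟩ := h.exists_eLpNorm_le
  refine ⟨fun i => (h.aestronglyMeasurable i).sub integrable_condExp.aestronglyMeasurable,
    C + C, fun i => ?_⟩
  calc eLpNorm (X i - μ[X i | ℱ i]) p μ
      ≤ eLpNorm (X i) p μ + eLpNorm (μ[X i | ℱ i]) p μ :=
        eLpNorm_sub_le (h.aestronglyMeasurable i) integrable_condExp.aestronglyMeasurable hp
    _ ≤ C + C := add_le_add (hC i) ((eLpNorm_condExp_le_eLpNorm _ hp).trans (hC i))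
    _ = (C + C : ℝ≥0) := by push_cast; rfl

lemma exists_integral_sq_le (h : LpBounded X 2 μ) : ∃ C, ∀ i, ∫ ω, X i ω ^ 2 ∂μ ≤ C := by
  obtain ⟨C, hC⟩ := h.exists_eLpNorm_le
  refine ⟨(C : ℝ) ^ 2, fun i => ?_⟩
  have hnorm := (h.memLp i).eLpNorm_eq_integral_rpow_norm two_ne_zero ENNReal.ofNat_ne_top
  have hi := hnorm ▸ hC i
  rw [← ENNReal.ofReal_coe_nnreal, ENNReal.ofReal_le_ofReal_iff C.coe_nonneg,
    Real.rpow_inv_le_iff_of_pos (by positivity) C.coe_nonneg (by simp)] at hi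
  simpa using hi

end LpBounded

namespace IsL2MartingaleDiff

lemma of_sub_condExp [IsFiniteMeasure μ] (hUm : ∀ i, StronglyMeasurable[ℱ (i + 1)] (U i))
    (hU : ∀ i, MemLp (U i) 2 μ) : IsL2MartingaleDiff ℱ μ (fun i => U i - μ[U i | ℱ i]) where
  stronglyMeasurable i := (hUm i).sub (stronglyMeasurable_condExp.mono (ℱ.mono i.le_succ))
  memLp i := (hU i).sub ((hU i).condExp one_le_two)
  condExp_eq_zero i := by
    refine (condExp_sub ((hU i).integrable one_le_two) integrable_condExp (ℱ i)).trans ?_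
    rw [condExp_of_stronglyMeasurable (ℱ.le i) stronglyMeasurable_condExp integrable_condExp,
      sub_self]

lemma const_mul (hX : IsL2MartingaleDiff ℱ μ X) (c : ℕ → ℝ) :
    IsL2MartingaleDiff ℱ μ (fun i => c i • X i) where
  stronglyMeasurable i := (hX.stronglyMeasurable i).const_smul (c i)
  memLp i := (hX.memLp i).const_smul (c i)
  condExp_eq_zero i := by
    filter_upwards [condExp_smul (c i) (X i) (ℱ i), hX.condExp_eq_zero i] with ω h h0
    simp [h, h0]

lemma stronglyMeasurable_sum (hX : IsL2MartingaleDiff ℱ μ X) (n : ℕ) :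
    StronglyMeasurable[ℱ n] (∑ i ∈ Finset.range n, X i) :=
  Finset.stronglyMeasurable_sum _ fun i hi =>
    (hX.stronglyMeasurable i).mono (ℱ.mono (Finset.mem_range.1 hi))

lemma memLp_sum (hX : IsL2MartingaleDiff ℱ μ X) (n : ℕ) :
    MemLp (∑ i ∈ Finset.range n, X i) 2 μ :=
  memLp_finsetSum' _ fun i _ => hX.memLp i

variable [IsFiniteMeasure μ]

lemma martingale (hX : IsL2MartingaleDiff ℱ μ X) :
    Martingale (fun n => ∑ i ∈ Finset.range n, X i) ℱ μ := by
  refine martingale_of_condExp_sub_eq_zero_nat hX.stronglyMeasurable_sum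
    (fun n => (hX.memLp_sum n).integrable one_le_two) fun n => ?_
  simpa [Finset.sum_range_succ] using hX.condExp_eq_zero n

lemma integral_sum_mul_eq_zero (hX : IsL2MartingaleDiff ℱ μ X) (n : ℕ) :
    ∫ ω, (∑ i ∈ Finset.range n, X i) ω * X n ω ∂μ = 0 := by
  have hpull := condExp_mul_of_stronglyMeasurable_left (hX.stronglyMeasurable_sum n)
    ((hX.memLp_sum n).integrable_mul (hX.memLp n)) ((hX.memLp n).integrable one_le_two)
  rw [← integral_condExp (ℱ.le n)]
  refine integral_eq_zero_of_ae ?_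
  filter_upwards [hpull, hX.condExp_eq_zero n] with ω hω h0
  exact hω.trans (by simp [h0])

lemma integral_sq_sum (hX : IsL2MartingaleDiff ℱ μ X) (n : ℕ) :
    ∫ ω, (∑ i ∈ Finset.range n, X i) ω ^ 2 ∂μ = ∑ i ∈ Finset.range n, ∫ ω, X i ω ^ 2 ∂μ := by
  induction n with
  | zero => simp
  | succ n ih =>
    have hsum := (hX.memLp_sum n).integrable_sq
    have hcross : Integrable (fun ω => 2 * ((∑ i ∈ Finset.range n, X i) ω * X n ω)) μ :=
      ((hX.memLp_sum n).integrable_mul (hX.memLp n)).const_mul 2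
    have hexpand (ω : Ω) : (∑ i ∈ Finset.range (n + 1), X i) ω ^ 2
        = (∑ i ∈ Finset.range n, X i) ω ^ 2
          + 2 * ((∑ i ∈ Finset.range n, X i) ω * X n ω) + X n ω ^ 2 := by
      rw [Finset.sum_range_succ, Pi.add_apply]
      ring
    simp only [hexpand]
    have hquad : Integrable (fun ω => (∑ i ∈ Finset.range n, X i) ω ^ 2
        + 2 * ((∑ i ∈ Finset.range n, X i) ω * X n ω)) μ := hsum.add hcross
    rw [integral_add hquad (hX.memLp n).integrable_sq, integral_add hsum hcross,
      integral_const_mul, hX.integral_sum_mul_eq_zero n, ih, Finset.sum_range_succ]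
    ring

lemma exists_ae_tendsto_sum (hX : IsL2MartingaleDiff ℱ μ X)
    (hs : Summable fun i => ∫ ω, X i ω ^ 2 ∂μ) :
    ∀ᵐ ω ∂μ, ∃ a, Tendsto (fun n => (∑ i ∈ Finset.range n, X i) ω) atTop (𝓝 a) := by
  refine hX.martingale.submartingale.exists_ae_tendsto_of_bdd
    (R := Real.toNNReal (μ.real Set.univ + ∑' i, ∫ ω, X i ω ^ 2 ∂μ)) fun n => ?_
  have hint := (hX.memLp_sum n).integrable one_le_two
  have hsq := (hX.memLp_sum n).integrable_sq
  rw [eLpNorm_one_eq_lintegral_enorm, ← ofReal_integral_norm_eq_lintegral_enorm hint]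
  refine ENNReal.ofReal_le_ofReal ?_
  calc ∫ ω, ‖(∑ i ∈ Finset.range n, X i) ω‖ ∂μ
      ≤ ∫ ω, (1 + (∑ i ∈ Finset.range n, X i) ω ^ 2) ∂μ := by
        refine integral_mono hint.norm ((integrable_const _).add hsq) fun ω => ?_
        nlinarith [sq_abs ((∑ i ∈ Finset.range n, X i) ω),
          sq_nonneg (‖(∑ i ∈ Finset.range n, X i) ω‖ - 1),
          Real.norm_eq_abs ((∑ i ∈ Finset.range n, X i) ω)]
    _ = μ.real Set.univ + ∑ i ∈ Finset.range n, ∫ ω, X i ω ^ 2 ∂μ := by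
        rw [integral_add (integrable_const _) hsq, hX.integral_sq_sum n]
        simp
    _ ≤ μ.real Set.univ + ∑' i, ∫ ω, X i ω ^ 2 ∂μ :=
        (add_le_add_iff_left _).2
          (hs.sum_le_tsum _ fun i _ => integral_nonneg fun ω => sq_nonneg _)

theorem ae_tendsto_avg (hX : IsL2MartingaleDiff ℱ μ X) {C : ℝ}
    (hC : ∀ i, ∫ ω, X i ω ^ 2 ∂μ ≤ C) :
    ∀ᵐ ω ∂μ, Tendsto (avg fun i => X i ω) atTop (𝓝 0) := by
  have hs : Summable fun i : ℕ => ∫ ω, (((i : ℝ) + 1)⁻¹ • X i) ω ^ 2 ∂μ := by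
    have hinv : Summable fun i : ℕ => (((i : ℝ) + 1)⁻¹) ^ 2 := by
      simpa using (summable_nat_add_iff 1).2 (Real.summable_nat_pow_inv.2 one_lt_two)
    refine (hinv.mul_right C).of_nonneg_of_le (fun i => integral_nonneg fun ω => sq_nonneg _)
      fun i => ?_
    simp only [Pi.smul_apply, smul_eq_mul, mul_pow, integral_const_mul]
    exact mul_le_mul_of_nonneg_left (hC i) (sq_nonneg _)
  filter_upwards [(hX.const_mul _).exists_ae_tendsto_sum hs] with ω ⟨a, ha⟩
  exact tendsto_avg_of_tendsto_sum_div (a := a) (by simpa using ha)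

end IsL2MartingaleDiff

theorem LpBounded.ae_tendsto_avg_sub_condExp [IsFiniteMeasure μ] (hU : LpBounded U 2 μ)
    (hUm : ∀ i, StronglyMeasurable[ℱ (i + 1)] (U i)) :
    ∀ᵐ ω ∂μ, Tendsto (avg fun i => U i ω - μ[U i | ℱ i] ω) atTop (𝓝 0) :=
  have ⟨_, hC⟩ := (hU.sub_condExp (ℱ := ℱ) one_le_two).exists_integral_sq_le
  (IsL2MartingaleDiff.of_sub_condExp hUm hU.memLp).ae_tendsto_avg hC

end LawOfLargeNumbers

section LpBounded

open scoped ENNReal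

variable {Ω : Type*} {m0 : MeasurableSpace Ω} {μ : Measure Ω} {X Y Z : ℕ → Ω → ℝ} {p q r : ℝ≥0∞}

namespace LpBounded

lemma mono (hY : LpBounded Y p μ) (hX : ∀ i, AEStronglyMeasurable (X i) μ)
    (h : ∀ i, ∀ᵐ ω ∂μ, ‖X i ω‖ ≤ ‖Y i ω‖) : LpBounded X p μ :=
  ⟨hX, hY.exists_eLpNorm_le.imp fun _ hC i => (eLpNorm_mono_ae (h i)).trans (hC i)⟩

lemma succ (hX : LpBounded X p μ) : LpBounded (fun i => X (i + 1)) p μ :=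
  ⟨fun i => hX.aestronglyMeasurable (i + 1), hX.exists_eLpNorm_le.imp fun _ hC i => hC (i + 1)⟩

lemma const (f : Ω → ℝ) (hf : MemLp f p μ) : LpBounded (fun _ => f) p μ :=
  ⟨fun _ => hf.1, (eLpNorm f p μ).toNNReal, fun _ => (ENNReal.coe_toNNReal hf.2.ne).ge⟩

lemma const_mul (hX : LpBounded X p μ) (c : ℝ) : LpBounded (fun i ω => c * X i ω) p μ := by
  obtain ⟨C, hC⟩ := hX.exists_eLpNorm_le
  refine ⟨fun i => (hX.aestronglyMeasurable i).const_mul c, ‖c‖₊ * C, fun i => ?_⟩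
  calc eLpNorm (c • X i) p μ ≤ ‖c‖ₑ * eLpNorm (X i) p μ := eLpNorm_const_smul_le
    _ ≤ ‖c‖ₑ * C := by gcongr; exact hC i
    _ = (‖c‖₊ * C : ℝ≥0) := by rw [ENNReal.coe_mul, enorm_eq_nnnorm]

lemma add (hX : LpBounded X p μ) (hY : LpBounded Y p μ) (hp : 1 ≤ p) :
    LpBounded (fun i ω => X i ω + Y i ω) p μ := by
  obtain ⟨C, hC⟩ := hX.exists_eLpNorm_le
  obtain ⟨C', hC'⟩ := hY.exists_eLpNorm_le
  have hXm := hX.aestronglyMeasurable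
  have hYm := hY.aestronglyMeasurable
  exact ⟨fun i => (hXm i).add (hYm i), C + C', fun i =>
    (eLpNorm_add_le (hXm i) (hYm i) hp).trans (by push_cast; exact add_le_add (hC i) (hC' i))⟩

lemma mul (hX : LpBounded X p μ) (hY : LpBounded Y q μ) [ENNReal.HolderTriple p q r] :
    LpBounded (fun i ω => X i ω * Y i ω) r μ := by
  obtain ⟨C, hC⟩ := hX.exists_eLpNorm_le
  obtain ⟨C', hC'⟩ := hY.exists_eLpNorm_le
  have hXm := hX.aestronglyMeasurable
  have hYm := hY.aestronglyMeasurable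
  exact ⟨fun i => (hXm i).mul (hYm i), C * C', fun i =>
    (eLpNorm_smul_le_mul_eLpNorm (hYm i) (hXm i)).trans
      (by push_cast; exact mul_le_mul' (hC i) (hC' i))⟩

lemma of_contraction (hX : ∀ i, AEStronglyMeasurable (X i) μ) (h0 : MemLp (X 0) p μ)
    (hZ : LpBounded Z p μ) (hp : 1 ≤ p) {ρ : ℝ} (hρ0 : 0 ≤ ρ) (hρ1 : ρ < 1)
    (h : ∀ i, ∀ᵐ ω ∂μ, ‖X (i + 1) ω‖ ≤ ρ * ‖X i ω‖ + ‖Z i ω‖) : LpBounded X p μ := by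
  lift ρ to ℝ≥0 using hρ0
  obtain ⟨C, hC⟩ := hZ.exists_eLpNorm_le
  set M := (eLpNorm (X 0) p μ).toNNReal + C / (1 - ρ)
  have hM : ρ * M + C ≤ M := by
    have hρ : 0 < 1 - (ρ : ℝ) := sub_pos.2 hρ1
    rw [← NNReal.coe_le_coe]
    simp only [M, NNReal.coe_add, NNReal.coe_mul, NNReal.coe_div,
      NNReal.coe_sub (show ρ ≤ 1 from hρ1.le), NNReal.coe_one]
    have hfix : ρ * (C / (1 - ρ : ℝ)) + C = C / (1 - ρ : ℝ) := by field_simp; ring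
    nlinarith [(eLpNorm (X 0) p μ).toNNReal.coe_nonneg]
  refine ⟨hX, M, fun i => ?_⟩
  induction i with
  | zero =>
    rw [← ENNReal.coe_toNNReal h0.2.ne]
    exact ENNReal.coe_le_coe.2 le_self_add
  | succ i ih =>
    have hZm := (hZ.aestronglyMeasurable i).norm
    calc eLpNorm (X (i + 1)) p μ
        ≤ eLpNorm ((ρ : ℝ) • (fun ω => ‖X i ω‖) + fun ω => ‖Z i ω‖) p μ :=
          eLpNorm_mono_ae_real (h i)
      _ ≤ ‖(ρ : ℝ)‖ₑ * eLpNorm (X i) p μ + eLpNorm (Z i) p μ := by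
          refine (eLpNorm_add_le ((hX i).norm.const_smul _) hZm hp).trans ?_
          rw [eLpNorm_const_smul, eLpNorm_norm, eLpNorm_norm]
      _ ≤ ρ * M + C := by
          rw [enorm_eq_nnnorm, Real.nnnorm_of_nonneg ρ.coe_nonneg]
          gcongr
          exacts [le_rfl, hC i]
      _ ≤ M := by exact_mod_cast hM

lemma of_rpow {s : ℝ} (hs : 0 < s) (hX : ∀ i, AEStronglyMeasurable (X i) μ)
    (h : LpBounded (fun i ω => ‖X i ω‖ ^ s) p μ) : LpBounded X (p * ENNReal.ofReal s) μ := by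
  obtain ⟨C, hC⟩ := h.exists_eLpNorm_le
  refine ⟨hX, C ^ s⁻¹, fun i => ?_⟩
  have hi := hC i
  rw [eLpNorm_norm_rpow _ hs, ← ENNReal.le_rpow_inv_iff hs] at hi
  rwa [ENNReal.coe_rpow_of_nonneg _ (inv_nonneg.2 hs.le)]

end LpBounded

end LpBounded

section Poisson

open scoped ENNReal

lemma hasSum_poissonMeasure_mul_exp (r : ℝ≥0) (s : ℝ) :
    HasSum (fun k : ℕ => Real.exp (-r) * r ^ k / k.factorial * Real.exp (s * k))
      (Real.exp (r * (Real.exp s - 1))) := by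
  have hexp := (NormedSpace.expSeries_div_hasSum_exp (r * Real.exp s)).mul_left (Real.exp (-r))
  rw [← Real.exp_eq_exp_ℝ, ← Real.exp_add,
    show (-r : ℝ) + r * Real.exp s = r * (Real.exp s - 1) by ring] at hexp
  refine hexp.congr_fun fun k => ?_
  rw [mul_pow, ← Real.exp_nat_mul, mul_comm s]
  ring

lemma integrable_exp_poissonMeasure (r : ℝ≥0) (s : ℝ) :
    Integrable (fun k : ℕ => Real.exp (s * k)) (poissonMeasure r) := by
  rw [integrable_poissonMeasure_iff]
  simpa only [Real.norm_eq_abs, Real.abs_exp] using (hasSum_poissonMeasure_mul_exp r s).summable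

lemma integral_exp_poissonMeasure (r : ℝ≥0) (s : ℝ) :
    ∫ k, Real.exp (s * k) ∂poissonMeasure r = Real.exp (r * (Real.exp s - 1)) :=
  (integral_poissonMeasure r _).trans (hasSum_poissonMeasure_mul_exp r s).tsum_eq

lemma integral_natCast_poissonMeasure (r : ℝ≥0) : ∫ k : ℕ, (k : ℝ) ∂poissonMeasure r = r := by
  rw [integral_poissonMeasure]
  refine HasSum.tsum_eq ((hasSum_nat_add_iff' 1).1 ?_)
  simp only [Finset.range_one, Finset.sum_singleton, Nat.cast_zero, smul_zero, sub_zero]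
  have hone := (hasSum_one_poissonMeasure r).mul_left (r : ℝ)
  rw [mul_one] at hone
  refine hone.congr_fun fun k => ?_
  rw [Nat.factorial_succ, pow_succ, smul_eq_mul]
  push_cast
  have : (k.factorial : ℝ) ≠ 0 := by exact_mod_cast k.factorial_ne_zero
  field_simp

lemma measurable_poissonMeasure_singleton (k : ℕ) :
    Measurable fun r : ℝ≥0 => poissonMeasure r {k} := by
  simp only [poissonMeasure_singleton]
  fun_prop

lemma measurable_lintegral_poissonMeasure {Ω : Type*} {mΩ : MeasurableSpace Ω} {r : Ω → ℝ≥0}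
    (hr : Measurable r) {G : Ω → ℕ → ℝ≥0∞} (hG : ∀ k, Measurable fun ω => G ω k) :
    Measurable fun ω => ∫⁻ k, G ω k ∂poissonMeasure (r ω) := by
  simp only [lintegral_countable']
  exact Measurable.tsum fun k => (hG k).mul ((measurable_poissonMeasure_singleton k).comp hr)

lemma exists_le_poissonMeasure_real_singleton (k : ℕ) {m : ℝ} (hm : 0 < m) (K : ℝ) :
    ∃ c > 0, ∀ r : ℝ≥0, m ≤ r → r ≤ K → c ≤ (poissonMeasure r).real {k} := by
  refine ⟨Real.exp (-K) * m ^ k / k.factorial, by positivity, fun r hmr hrK => ?_⟩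
  rw [poissonMeasure_real_singleton]
  gcongr

variable {Ω : Type*} {m m0 : MeasurableSpace Ω} {μ : Measure Ω} {N : Ω → ℕ} {r : Ω → ℝ≥0}

/-- The conditional law of `N` given the σ-algebra `m` is Poisson with the `m`-measurable
mean `r`. -/
structure IsCondPoisson (μ : Measure[m0] Ω) (m : MeasurableSpace Ω) (N : Ω → ℕ) (r : Ω → ℝ≥0) :
    Prop where
  le : m ≤ m0
  measurable : Measurable[m0] N
  measurable_mean : Measurable[m] r
  condExp_indicator : ∀ k, μ[(N ⁻¹' {k}).indicator (fun _ => (1 : ℝ)) | m]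
    =ᵐ[μ] fun ω => (poissonMeasure (r ω)).real {k}

namespace IsCondPoisson

lemma measurable_poissonMeasure (h : IsCondPoisson μ m N r) (k : ℕ) :
    Measurable[m] fun ω => poissonMeasure (r ω) {k} :=
  (measurable_poissonMeasure_singleton k).comp h.measurable_mean

variable [IsFiniteMeasure μ]

lemma measure_inter_preimage (h : IsCondPoisson μ m N r) (k : ℕ) {S : Set Ω}
    (hS : MeasurableSet[m] S) :
    μ (S ∩ N ⁻¹' {k}) = ∫⁻ ω in S, poissonMeasure (r ω) {k} ∂μ := by
  have hk : MeasurableSet (N ⁻¹' {k}) := h.measurable (measurableSet_singleton k)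
  have hset := setIntegral_condExp h.le ((integrable_const (μ := μ) (1 : ℝ)).indicator hk) hS
  rw [integral_congr_ae (ae_restrict_of_ae (h.condExp_indicator k)), integral_indicator hk,
    Measure.restrict_restrict hk, setIntegral_const, smul_eq_mul, mul_one] at hset
  have hreal := (integrable_condExp (μ := μ)).congr (h.condExp_indicator k)
  rw [Set.inter_comm, ← ofReal_measureReal, ← hset,
    ofReal_integral_eq_lintegral_ofReal hreal.integrableOn
      (ae_of_all _ fun ω => measureReal_nonneg)]
  exact lintegral_congr fun ω => ofReal_measureReal

lemma setLIntegral_preimage (h : IsCondPoisson μ m N r) {Z : Ω → ℝ≥0∞}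
    (hZ : Measurable[m] Z) (k : ℕ) :
    ∫⁻ ω in N ⁻¹' {k}, Z ω ∂μ = ∫⁻ ω, Z ω * poissonMeasure (r ω) {k} ∂μ := by
  have htrim : (μ.restrict (N ⁻¹' {k})).trim h.le
      = (μ.withDensity fun ω => poissonMeasure (r ω) {k}).trim h.le := by
    refine @Measure.ext _ m _ _ fun S hS => ?_
    rw [trim_measurableSet_eq _ hS, trim_measurableSet_eq _ hS, Measure.restrict_apply (h.le _ hS),
      withDensity_apply _ (h.le _ hS), h.measure_inter_preimage k hS]
  rw [← lintegral_trim h.le hZ, htrim, lintegral_trim h.le hZ,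
    lintegral_withDensity_eq_lintegral_mul _ ((h.measurable_poissonMeasure k).mono h.le le_rfl)
      (hZ.mono h.le le_rfl)]
  simp only [Pi.mul_apply, mul_comm]

lemma lintegral_comp (h : IsCondPoisson μ m N r) {G : Ω → ℕ → ℝ≥0∞}
    (hG : ∀ k, Measurable[m] fun ω => G ω k) :
    ∫⁻ ω, G ω (N ω) ∂μ = ∫⁻ ω, ∫⁻ k, G ω k ∂poissonMeasure (r ω) ∂μ := by
  have hk (k : ℕ) : MeasurableSet (N ⁻¹' {k}) := h.measurable (measurableSet_singleton k)
  have hG0 (k : ℕ) : Measurable fun ω => G ω k := (hG k).mono h.le le_rfl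
  have hGr (k : ℕ) : Measurable fun ω => G ω k * poissonMeasure (r ω) {k} :=
    (hG0 k).mul ((h.measurable_poissonMeasure k).mono h.le le_rfl)
  have hsplit (ω : Ω) : G ω (N ω) = ∑' k, (N ⁻¹' {k}).indicator (fun ω => G ω k) ω := by
    rw [tsum_eq_single (N ω) fun k hk => Set.indicator_of_notMem (fun h' => hk h'.symm) _,
      Set.indicator_of_mem (by rfl)]
  simp only [hsplit, lintegral_countable']
  rw [lintegral_tsum fun k => ((hG0 k).indicator (hk k)).aemeasurable,
    lintegral_tsum fun k => (hGr k).aemeasurable]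
  refine tsum_congr fun k => ?_
  rw [lintegral_indicator (hk k), h.setLIntegral_preimage (hG k)]

lemma setLIntegral_comp (h : IsCondPoisson μ m N r) {G : Ω → ℕ → ℝ≥0∞}
    (hG : ∀ k, Measurable[m] fun ω => G ω k) {S : Set Ω} (hS : MeasurableSet[m] S) :
    ∫⁻ ω in S, G ω (N ω) ∂μ = ∫⁻ ω in S, ∫⁻ k, G ω k ∂poissonMeasure (r ω) ∂μ := by
  have hind := h.lintegral_comp fun k => (hG k).indicator hS
  rw [← lintegral_indicator (h.le S hS), ← lintegral_indicator (h.le S hS)]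
  convert hind using 2 <;>
  · ext ω
    by_cases hω : ω ∈ S <;> simp [hω]

lemma condExp_comp (h : IsCondPoisson μ m N r) {G : Ω → ℕ → ℝ}
    (hG : ∀ k, Measurable[m] fun ω => G ω k) (hG0 : ∀ ω k, 0 ≤ G ω k)
    (hint : Integrable (fun ω => G ω (N ω)) μ) :
    μ[fun ω => G ω (N ω) | m] =ᵐ[μ] fun ω => ∫ k, G ω k ∂poissonMeasure (r ω) := by
  set I : Ω → ℝ≥0∞ := fun ω => ∫⁻ k, ENNReal.ofReal (G ω k) ∂poissonMeasure (r ω)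
  have hI : Measurable[m] I :=
    measurable_lintegral_poissonMeasure h.measurable_mean fun k =>
      ENNReal.measurable_ofReal.comp (hG k)
  have hset (S : Set Ω) (hS : MeasurableSet[m] S) :
      ∫⁻ ω in S, ENNReal.ofReal (G ω (N ω)) ∂μ = ∫⁻ ω in S, I ω ∂μ :=
    h.setLIntegral_comp (fun k => ENNReal.measurable_ofReal.comp (hG k)) hS
  have hfin : ∫⁻ ω, I ω ∂μ ≠ ∞ := by
    have huniv := hset Set.univ MeasurableSet.univ
    rw [Measure.restrict_univ] at huniv
    rw [← huniv]
    exact ((lintegral_ofReal_ne_top_iff_integrable hint.1 (ae_of_all _ fun ω => hG0 ω _)).2 hint)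
  have hI0 := hI.mono h.le le_rfl
  have hIint := integrable_toReal_of_lintegral_ne_top hI0.aemeasurable hfin
  have hItop := ae_lt_top hI0 hfin
  have hIeq : (fun ω => ∫ k, G ω k ∂poissonMeasure (r ω)) = fun ω => (I ω).toReal := by
    ext ω
    exact integral_eq_lintegral_of_nonneg_ae (ae_of_all _ (hG0 ω)) .of_discrete
  rw [hIeq]
  refine (ae_eq_condExp_of_forall_setIntegral_eq h.le hint (fun S _ _ => hIint.integrableOn)
    (fun S hS _ => ?_) hI.ennreal_toReal.stronglyMeasurable.aestronglyMeasurable).symm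
  rw [integral_toReal hI0.aemeasurable (ae_restrict_of_ae hItop), ← hset S hS,
    integral_eq_lintegral_of_nonneg_ae (ae_of_all _ fun ω => hG0 ω _) hint.1.restrict]

lemma condExp_natCast (h : IsCondPoisson μ m N r)
    (hint : Integrable (fun ω => (N ω : ℝ)) μ) :
    μ[fun ω => (N ω : ℝ) | m] =ᵐ[μ] fun ω => (r ω : ℝ) := by
  simpa only [integral_natCast_poissonMeasure] using
    h.condExp_comp (G := fun _ k => (k : ℝ)) (fun _ => measurable_const)
      (fun _ k => k.cast_nonneg) hint

end IsCondPoisson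

end Poisson

section Drift

/-- The Foster–Lyapunov drift condition with Lyapunov function `l ↦ exp (u * l)` for the Markov
chain of the intensities. -/
structure HasExpDrift (θ : Param) (u C : ℝ) : Prop where
  pos : 0 < u
  nonneg : 0 ≤ C
  integral_le : ∀ l : ℝ≥0,
    ∫ k, Real.exp (u * intensity θ k l) ∂poissonMeasure l ≤ 1 / 2 * Real.exp (u * l) + C

variable {δ ρ B u κ : ℝ} {θ : Param}

lemma CoefBounds.exp_intensity_le (h : CoefBounds δ ρ B θ) (hu : 0 ≤ u) (y : ℕ) (l : ℝ) :
    Real.exp (u * intensity θ y l) ≤ Real.exp (u * (θ.d₁ + θ.b₁ * θ.1 + θ.d₂))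
      * (Real.exp (u * θ.a₁ * l) + Real.exp (u * θ.a₂ * l) * Real.exp (u * θ.b₂ * y)) := by
  have hpos (i : Fin 6) : 0 < θ.2 i := h.pos.trans_le (h.le_coef i)
  have hd₁ : 0 < θ.d₁ := hpos 0
  have hd₂ : 0 < θ.d₂ := hpos 3
  have hb₁ : 0 < θ.b₁ := hpos 2
  rw [mul_add, ← Real.exp_add, ← Real.exp_add, ← Real.exp_add, intensity]
  split_ifs with hy
  · refine le_add_of_le_of_nonneg (Real.exp_le_exp.2 ?_) (Real.exp_pos _).le
    calc u * (θ.d₁ + θ.a₁ * l + θ.b₁ * y) ≤ u * (θ.d₁ + θ.a₁ * l + θ.b₁ * θ.1 + θ.d₂) := by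
          refine mul_le_mul_of_nonneg_left ?_ hu
          linarith [mul_le_mul_of_nonneg_left (Nat.cast_le (α := ℝ).2 hy) hb₁.le]
      _ = u * (θ.d₁ + θ.b₁ * θ.1 + θ.d₂) + u * θ.a₁ * l := by ring
  · refine le_add_of_nonneg_of_le (Real.exp_pos _).le (Real.exp_le_exp.2 ?_)
    have hr : 0 ≤ θ.b₁ * θ.1 := by positivity
    calc u * (θ.d₂ + θ.a₂ * l + θ.b₂ * y)
        ≤ u * (θ.d₁ + θ.b₁ * θ.1 + θ.d₂ + θ.a₂ * l + θ.b₂ * y) :=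
          mul_le_mul_of_nonneg_left (by linarith) hu
      _ = u * (θ.d₁ + θ.b₁ * θ.1 + θ.d₂) + (u * θ.a₂ * l + u * θ.b₂ * y) := by ring

lemma exp_mul_sub_one_le {b : ℝ} (hb : 0 ≤ b) (hb1 : b ≤ 1) (hu : 0 ≤ u) (hu1 : u ≤ 1) :
    Real.exp (u * b) - 1 ≤ u * (b + u) := by
  have hub : u * b ≤ u := mul_le_of_le_one_right hu hb1
  have hub0 : 0 ≤ u * b := mul_nonneg hu hb
  have htaylor := le_of_abs_le (Real.abs_exp_sub_one_sub_id_le (x := u * b)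
    ((abs_of_nonneg hub0).trans_le (hub.trans hu1)))
  nlinarith [pow_le_pow_left₀ hub0 hub 2]

lemma CoefBounds.integrable_exp_intensity (h : CoefBounds δ ρ B θ) (hu : 0 ≤ u) (l : ℝ) (r : ℝ≥0) :
    Integrable (fun k => Real.exp (u * intensity θ k l)) (poissonMeasure r) := by
  refine Integrable.mono' (((integrable_const (Real.exp (u * θ.a₁ * l))).add
    ((integrable_exp_poissonMeasure r (u * θ.b₂)).const_mul (Real.exp (u * θ.a₂ * l)))).const_mul
      (Real.exp (u * (θ.d₁ + θ.b₁ * θ.1 + θ.d₂)))) .of_discrete (ae_of_all _ fun k => ?_)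
  rw [Real.norm_eq_abs, Real.abs_exp]
  exact h.exp_intensity_le hu k l

lemma CoefBounds.integral_exp_intensity_le (h : CoefBounds δ ρ B θ) (hu : 0 ≤ u) (hu1 : u ≤ 1)
    (hb₂ : θ.b₂ ≤ 1) (hκ₁ : θ.a₁ ≤ κ) (hκ₂ : θ.a₂ + θ.b₂ + u ≤ κ) (l : ℝ≥0) :
    ∫ k, Real.exp (u * intensity θ k l) ∂poissonMeasure l
      ≤ 2 * Real.exp (u * (θ.d₁ + θ.b₁ * θ.1 + θ.d₂)) * Real.exp (u * κ * l) := by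
  set c := Real.exp (u * (θ.d₁ + θ.b₁ * θ.1 + θ.d₂))
  have hb₂0 : 0 ≤ θ.b₂ := h.pos.le.trans (h.le_coef 5)
  have hexp := (integrable_exp_poissonMeasure l (u * θ.b₂)).const_mul (Real.exp (u * θ.a₂ * l))
  have hupper : Real.exp (u * θ.a₂ * l) * Real.exp (l * (Real.exp (u * θ.b₂) - 1))
      ≤ Real.exp (u * κ * l) := by
    rw [← Real.exp_add, Real.exp_le_exp]
    calc u * θ.a₂ * l + l * (Real.exp (u * θ.b₂) - 1)
        ≤ u * θ.a₂ * l + l * (u * (θ.b₂ + u)) := by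
          gcongr; exact exp_mul_sub_one_le hb₂0 hb₂ hu hu1
      _ = u * (θ.a₂ + θ.b₂ + u) * l := by ring
      _ ≤ u * κ * l := by gcongr
  calc ∫ k, Real.exp (u * intensity θ k l) ∂poissonMeasure l
      ≤ ∫ k : ℕ, c * (Real.exp (u * θ.a₁ * l) + Real.exp (u * θ.a₂ * l) * Real.exp (u * θ.b₂ * k))
          ∂poissonMeasure l :=
        integral_mono (h.integrable_exp_intensity hu l l)
          (((integrable_const _).add hexp).const_mul c) fun k => h.exp_intensity_le hu k l
    _ = c * (Real.exp (u * θ.a₁ * l)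
          + Real.exp (u * θ.a₂ * l) * Real.exp (l * (Real.exp (u * θ.b₂) - 1))) := by
        rw [integral_const_mul, integral_add (integrable_const _) hexp, integral_const_mul,
          integral_exp_poissonMeasure]
        simp
    _ ≤ c * (Real.exp (u * κ * l) + Real.exp (u * κ * l)) := by gcongr
    _ = 2 * c * Real.exp (u * κ * l) := by ring

lemma exists_mul_exp_le {M : ℝ} (hM : 0 < M) (hu : 0 < u) (hκ0 : 0 ≤ κ) (hκ : κ < 1) :
    ∃ C ≥ 0, ∀ l, M * Real.exp (u * κ * l) ≤ 1 / 2 * Real.exp (u * l) + C := by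
  set x₀ := Real.log (2 * M) / (u * (1 - κ)) with hx₀
  refine ⟨M * Real.exp (u * κ * x₀), by positivity, fun l => ?_⟩
  rcases le_total x₀ l with hl | hl
  · have hgap : 2 * M ≤ Real.exp (u * (1 - κ) * l) := by
      rw [hx₀, div_le_iff₀' (mul_pos hu (sub_pos.2 hκ))] at hl
      exact (Real.log_le_iff_le_exp (by positivity)).1 hl
    refine le_add_of_le_of_nonneg ?_ (by positivity)
    calc M * Real.exp (u * κ * l) = 1 / 2 * (2 * M * Real.exp (u * κ * l)) := by ring
      _ ≤ 1 / 2 * (Real.exp (u * (1 - κ) * l) * Real.exp (u * κ * l)) := by gcongr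
      _ = 1 / 2 * Real.exp (u * l) := by rw [← Real.exp_add]; ring_nf
  · refine le_add_of_nonneg_of_le (by positivity) ?_
    gcongr

theorem CoefBounds.exists_hasExpDrift (h : CoefBounds δ ρ B θ) (hab : θ.a₂ + θ.b₂ < 1) :
    ∃ u₀ > 0, ∀ u, 0 < u → u ≤ u₀ → ∃ C, HasExpDrift θ u C := by
  have ha₂ : 0 < θ.a₂ := h.pos.trans_le (h.le_coef 4)
  refine ⟨min 1 ((1 - θ.a₂ - θ.b₂) / 2), lt_min one_pos (by linarith), fun u hu hu₀ => ?_⟩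
  have hu1 : u ≤ 1 := hu₀.trans (min_le_left _ _)
  have hu2 : u ≤ (1 - θ.a₂ - θ.b₂) / 2 := hu₀.trans (min_le_right _ _)
  have hκ : max ρ (θ.a₂ + θ.b₂ + u) < 1 := max_lt h.lt_one (by linarith)
  obtain ⟨C, hC, hle⟩ := exists_mul_exp_le
    (M := 2 * Real.exp (u * (θ.d₁ + θ.b₁ * θ.1 + θ.d₂))) (by positivity) hu
    (h.rho_pos.le.trans (le_max_left _ _)) hκ
  exact ⟨C, hu, hC, fun l => (h.integral_exp_intensity_le hu.le hu1 (by linarith)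
    (h.a₁_le.trans (le_max_left _ _)) (le_max_right _ _) l).trans (hle l)⟩

end Drift

section PoissonModel

open scoped ENNReal

variable {Ω : Type*} {m0 : MeasurableSpace Ω} {μ : Measure Ω} {ℱ : Filtration ℕ m0}
  {θ₀ : Param} {N : ℕ → Ω → ℕ} {Λ : ℕ → Ω → ℝ≥0} {δ ρ B u C K : ℝ}

/-- The threshold autoregression as a one-sided process: given `ℱ i` the count `N i` is Poisson
with the `ℱ i`-measurable mean `Λ i`, and the means follow the threshold recursion. -/
structure PoissonModel (μ : Measure Ω) (ℱ : Filtration ℕ m0) (θ₀ : Param) (N : ℕ → Ω → ℕ)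
    (Λ : ℕ → Ω → ℝ≥0) : Prop where
  measurable_count : ∀ i, Measurable[ℱ (i + 1)] (N i)
  isCondPoisson : ∀ i, IsCondPoisson μ (ℱ i) (N i) (Λ i)
  isTraj : ∀ᵐ ω ∂μ, IsTraj θ₀ (fun i => N i ω) (fun i => (Λ i ω : ℝ))

lemma measurable_exp_intensity {mΩ : MeasurableSpace Ω} {r : Ω → ℝ≥0} (hr : Measurable r)
    (θ : Param) (u : ℝ) (k : ℕ) : Measurable fun ω => Real.exp (u * intensity θ k (r ω)) := by
  have hintensity := (continuous_intensity θ k).measurable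
  fun_prop

namespace PoissonModel

lemma measurable_mean (h : PoissonModel μ ℱ θ₀ N Λ) (i : ℕ) : Measurable[ℱ i] (Λ i) :=
  (h.isCondPoisson i).measurable_mean

lemma aestronglyMeasurable_mean (h : PoissonModel μ ℱ θ₀ N Λ) (i : ℕ) :
    AEStronglyMeasurable (fun ω => (Λ i ω : ℝ)) μ :=
  ((h.measurable_mean i).mono (ℱ.le i) le_rfl).coe_nnreal_real.aestronglyMeasurable

lemma ae_mean_succ (h : PoissonModel μ ℱ θ₀ N Λ) :
    ∀ᵐ ω ∂μ, ∀ i, (Λ (i + 1) ω : ℝ) = intensity θ₀ (N i ω) (Λ i ω) :=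
  h.isTraj

lemma ae_count_le (h : PoissonModel μ ℱ θ₀ N Λ) (hb : CoefBounds δ ρ B θ₀) :
    ∀ᵐ ω ∂μ, ∀ i, (N i ω : ℝ) ≤ δ⁻¹ * Λ (i + 1) ω := by
  filter_upwards [h.ae_mean_succ] with ω hω i
  rw [hω i, le_inv_mul_iff₀ hb.pos]
  nlinarith [hb.le_intensity (N i ω) (Λ i ω).coe_nonneg, hb.pos]

variable [IsFiniteMeasure μ]

lemma lintegral_exp_succ_le (h : PoissonModel μ ℱ θ₀ N Λ) (hb : CoefBounds δ ρ B θ₀)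
    (hd : HasExpDrift θ₀ u C) (i : ℕ) :
    ∫⁻ ω, ENNReal.ofReal (Real.exp (u * Λ (i + 1) ω)) ∂μ
      ≤ ENNReal.ofReal (1 / 2) * ∫⁻ ω, ENNReal.ofReal (Real.exp (u * Λ i ω)) ∂μ
        + ENNReal.ofReal C * μ Set.univ := by
  calc ∫⁻ ω, ENNReal.ofReal (Real.exp (u * Λ (i + 1) ω)) ∂μ
      = ∫⁻ ω, ENNReal.ofReal (Real.exp (u * intensity θ₀ (N i ω) (Λ i ω))) ∂μ := by
        refine lintegral_congr_ae ?_
        filter_upwards [h.ae_mean_succ] with ω hω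
        rw [hω i]
    _ = ∫⁻ ω, ∫⁻ k, ENNReal.ofReal (Real.exp (u * intensity θ₀ k (Λ i ω)))
          ∂poissonMeasure (Λ i ω) ∂μ :=
        (h.isCondPoisson i).lintegral_comp
          (G := fun ω k => ENNReal.ofReal (Real.exp (u * intensity θ₀ k (Λ i ω)))) fun k =>
          ENNReal.measurable_ofReal.comp (measurable_exp_intensity (h.measurable_mean i) θ₀ u k)
    _ ≤ ∫⁻ ω, ENNReal.ofReal (1 / 2 * Real.exp (u * Λ i ω) + C) ∂μ := by
        refine lintegral_mono fun ω => ?_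
        rw [← ofReal_integral_eq_lintegral_ofReal
          (hb.integrable_exp_intensity hd.pos.le _ _) (ae_of_all _ fun k => (Real.exp_pos _).le)]
        exact ENNReal.ofReal_le_ofReal (hd.integral_le _)
    _ = ENNReal.ofReal (1 / 2) * ∫⁻ ω, ENNReal.ofReal (Real.exp (u * Λ i ω)) ∂μ
        + ENNReal.ofReal C * μ Set.univ := by
        simp only [ENNReal.ofReal_add (by positivity : 0 ≤ 1 / 2 * Real.exp _) hd.nonneg,
          ENNReal.ofReal_mul (by norm_num : (0 : ℝ) ≤ 1 / 2)]
        rw [lintegral_add_right _ measurable_const,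
          lintegral_const_mul' _ _ ENNReal.ofReal_ne_top, lintegral_const]

lemma lintegral_exp_le (h : PoissonModel μ ℱ θ₀ N Λ) (hb : CoefBounds δ ρ B θ₀)
    (hd : HasExpDrift θ₀ u C) (hK : ∀ᵐ ω ∂μ, Λ 0 ω ≤ K) (i : ℕ) :
    ∫⁻ ω, ENNReal.ofReal (Real.exp (u * Λ i ω)) ∂μ
      ≤ ENNReal.ofReal (Real.exp (u * K) + 2 * C) * μ Set.univ := by
  have hC := hd.nonneg
  induction i with
  | zero =>
    refine (lintegral_mono_ae ?_).trans_eq (lintegral_const _)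
    filter_upwards [hK] with ω hω
    have hexp : Real.exp (u * Λ 0 ω) ≤ Real.exp (u * K) := by gcongr; exact hd.pos.le
    exact ENNReal.ofReal_le_ofReal (by linarith)
  | succ i ih =>
    calc ∫⁻ ω, ENNReal.ofReal (Real.exp (u * Λ (i + 1) ω)) ∂μ
        ≤ ENNReal.ofReal (1 / 2) * (ENNReal.ofReal (Real.exp (u * K) + 2 * C) * μ Set.univ)
          + ENNReal.ofReal C * μ Set.univ :=
          (h.lintegral_exp_succ_le hb hd i).trans (by gcongr)
      _ = ENNReal.ofReal (1 / 2 * (Real.exp (u * K) + 2 * C) + C) * μ Set.univ := by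
          rw [ENNReal.ofReal_add (by positivity) hC, ENNReal.ofReal_mul (by norm_num)]
          ring
      _ ≤ ENNReal.ofReal (Real.exp (u * K) + 2 * C) * μ Set.univ := by
          refine mul_le_mul_left (ENNReal.ofReal_le_ofReal ?_) _
          linarith [Real.exp_pos (u * K)]

lemma lpBounded_exp_mean (h : PoissonModel μ ℱ θ₀ N Λ) (hb : CoefBounds δ ρ B θ₀)
    (hd : HasExpDrift θ₀ u C) (hK : ∀ᵐ ω ∂μ, Λ 0 ω ≤ K) :
    LpBounded (fun i ω => Real.exp (u * Λ i ω)) 1 μ := by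
  refine ⟨fun i => Real.continuous_exp.comp_aestronglyMeasurable
    ((h.aestronglyMeasurable_mean i).const_mul u),
    (ENNReal.ofReal (Real.exp (u * K) + 2 * C) * μ Set.univ).toNNReal, fun i => ?_⟩
  rw [eLpNorm_one_eq_lintegral_enorm, ENNReal.coe_toNNReal (by finiteness)]
  simpa only [Real.enorm_of_nonneg (Real.exp_pos _).le] using h.lintegral_exp_le hb hd hK i

lemma lpBounded_exp_div_mean (h : PoissonModel μ ℱ θ₀ N Λ) (hb : CoefBounds δ ρ B θ₀)
    (hd : HasExpDrift θ₀ u C) (hK : ∀ᵐ ω ∂μ, Λ 0 ω ≤ K) {s : ℝ} (hs : 0 < s) :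
    LpBounded (fun i ω => Real.exp (u / s * Λ i ω)) (ENNReal.ofReal s) μ := by
  rw [← one_mul (ENNReal.ofReal s)]
  refine LpBounded.of_rpow hs (fun i => Real.continuous_exp.comp_aestronglyMeasurable
    ((h.aestronglyMeasurable_mean i).const_mul _)) ?_
  convert h.lpBounded_exp_mean hb hd hK using 3 with i ω
  rw [Real.norm_eq_abs, Real.abs_exp, ← Real.exp_mul]
  congr 1
  field_simp

lemma lpBounded_mean (h : PoissonModel μ ℱ θ₀ N Λ) (hb : CoefBounds δ ρ B θ₀)
    (hd : HasExpDrift θ₀ u C) (hK : ∀ᵐ ω ∂μ, Λ 0 ω ≤ K) {s : ℝ} (hs : 0 < s) :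
    LpBounded (fun i ω => (Λ i ω : ℝ)) (ENNReal.ofReal s) μ := by
  refine ((h.lpBounded_exp_div_mean hb hd hK hs).const_mul (u / s)⁻¹).mono
    h.aestronglyMeasurable_mean fun i => ae_of_all _ fun ω => ?_
  have hus : 0 < u / s := div_pos hd.pos hs
  rw [Real.norm_of_nonneg (Λ i ω).coe_nonneg, Real.norm_of_nonneg (by positivity),
    le_inv_mul_iff₀ hus]
  linarith [Real.add_one_le_exp (u / s * Λ i ω)]

lemma lpBounded_count (h : PoissonModel μ ℱ θ₀ N Λ) (hb : CoefBounds δ ρ B θ₀)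
    (hd : HasExpDrift θ₀ u C) (hK : ∀ᵐ ω ∂μ, Λ 0 ω ≤ K) {s : ℝ} (hs : 0 < s) :
    LpBounded (fun i ω => (N i ω : ℝ)) (ENNReal.ofReal s) μ := by
  refine ((h.lpBounded_mean hb hd hK hs).succ.const_mul δ⁻¹).mono (fun i => ?_) fun i => ?_
  · exact (measurable_of_countable fun k : ℕ => (k : ℝ)).comp
      (h.isCondPoisson i).measurable |>.aestronglyMeasurable
  · filter_upwards [h.ae_count_le hb] with ω hω
    rw [Real.norm_of_nonneg (N i ω).cast_nonneg]
    exact (hω i).trans (le_abs_self _)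

lemma condExp_exp_succ_le (h : PoissonModel μ ℱ θ₀ N Λ) (hd : HasExpDrift θ₀ u C) (i : ℕ)
    (hint : Integrable (fun ω => Real.exp (u * Λ (i + 1) ω)) μ) :
    ∀ᵐ ω ∂μ, (μ[fun ω => Real.exp (u * Λ (i + 1) ω) | ℱ i]) ω
      ≤ 1 / 2 * Real.exp (u * Λ i ω) + C := by
  have heq : (fun ω => Real.exp (u * Λ (i + 1) ω))
      =ᵐ[μ] fun ω => Real.exp (u * intensity θ₀ (N i ω) (Λ i ω)) := by
    filter_upwards [h.ae_mean_succ] with ω hω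
    rw [hω i]
  filter_upwards [condExp_congr_ae (m := ℱ i) heq, (h.isCondPoisson i).condExp_comp
    (G := fun ω k => Real.exp (u * intensity θ₀ k (Λ i ω)))
    (measurable_exp_intensity (h.measurable_mean i) θ₀ u) (fun ω k => (Real.exp_pos _).le)
    (hint.congr heq)] with ω hω hω'
  rw [hω, hω']
  exact hd.integral_le _

end PoissonModel

end PoissonModel

section PathwiseBounds

open scoped ENNReal

lemma avg_le_add_avg_succ {v : ℕ → ℝ} (hv : ∀ i, 0 ≤ v i) (n : ℕ) :
    avg v n ≤ v 0 + avg (fun i => v (i + 1)) n := by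
  rcases eq_or_ne n 0 with rfl | hn
  · simpa [avg] using hv 0
  calc avg v n ≤ (n : ℝ)⁻¹ * ∑ i ∈ Finset.range (n + 1), v i := by
        rw [avg, Finset.sum_range_succ]
        gcongr
        exact le_add_of_nonneg_right (hv n)
    _ = (n : ℝ)⁻¹ * v 0 + avg (fun i => v (i + 1)) n := by
        rw [Finset.sum_range_succ', avg]
        ring
    _ ≤ v 0 + avg (fun i => v (i + 1)) n := by
        gcongr
        refine mul_le_of_le_one_left (hv 0) (inv_le_one_of_one_le₀ ?_)
        exact_mod_cast Nat.one_le_iff_ne_zero.2 hn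

lemma avg_succ_le {v : ℕ → ℝ} (hv : ∀ i, 0 ≤ v i) (n : ℕ) :
    avg (fun i => v (i + 1)) n ≤ 2 * avg v (n + 1) := by
  rcases eq_or_ne n 0 with rfl | hn
  · simpa [avg] using hv 0
  have hn0 : 1 ≤ (n : ℝ) := mod_cast Nat.one_le_iff_ne_zero.2 hn
  have hinv : (n : ℝ)⁻¹ ≤ 2 * ((n + 1 : ℕ) : ℝ)⁻¹ := by
    rw [← div_eq_mul_inv, inv_eq_one_div, div_le_div_iff₀ (by positivity) (by positivity)]
    push_cast
    linarith
  calc avg (fun i => v (i + 1)) n ≤ (n : ℝ)⁻¹ * ∑ i ∈ Finset.range (n + 1), v i := by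
        rw [Finset.sum_range_succ', avg]
        gcongr
        exact le_add_of_nonneg_right (hv 0)
    _ ≤ 2 * ((n + 1 : ℕ) : ℝ)⁻¹ * ∑ i ∈ Finset.range (n + 1), v i :=
        mul_le_mul_of_nonneg_right hinv (Finset.sum_nonneg fun i _ => hv i)
    _ = 2 * avg v (n + 1) := mul_assoc _ _ _

lemma rms_succ_le {x : ℕ → ℝ} {M : ℝ} (h : ∀ n, rms x n ≤ M) (n : ℕ) :
    rms (fun i => x (i + 1)) n ≤ √(2 * M ^ 2) := by
  refine Real.sqrt_le_sqrt ((avg_succ_le (v := fun i => x i ^ 2) (fun i => sq_nonneg _) n).trans ?_)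
  rw [← sq_rms]
  gcongr
  exacts [rms_nonneg _ _, h (n + 1)]

lemma sq_le_mul_exp {a x : ℝ} (ha : 0 < a) (hx : 0 ≤ x) :
    x ^ 2 ≤ 2 * a⁻¹ ^ 2 * Real.exp (a * x) := by
  have hexp := Real.pow_div_factorial_le_exp (a * x) (mul_nonneg ha.le hx) 2
  rw [Nat.factorial_two, Nat.cast_ofNat] at hexp
  calc x ^ 2 = 2 * a⁻¹ ^ 2 * ((a * x) ^ 2 / 2) := by field_simp
    _ ≤ 2 * a⁻¹ ^ 2 * Real.exp (a * x) := by gcongr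

lemma abs_log_le_add {m x : ℝ} (hm : 0 < m) (hx : m ≤ x) : |Real.log x| ≤ |Real.log m| + x := by
  have hx0 : 0 < x := hm.trans_le hx
  refine abs_le.2 ⟨?_, ?_⟩
  · linarith [Real.log_le_log hm hx, neg_abs_le (Real.log m)]
  · linarith [Real.log_le_sub_one_of_pos hx0, abs_nonneg (Real.log m)]

lemma holderTriple_four_four_two : ENNReal.HolderTriple 4 4 2 where
  inv_add_inv_eq_inv := by
    rw [← two_mul, show (4 : ℝ≥0∞) = 2 * 2 by norm_num, ENNReal.mul_inv (by simp) (by simp),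
      ← mul_assoc, ENNReal.mul_inv_cancel two_ne_zero ENNReal.ofNat_ne_top, one_mul]

lemma exists_avg_le_of_drift {v w : ℕ → ℝ} {C : ℝ} (hv : ∀ i, 0 ≤ v i)
    (hw : ∀ i, w i ≤ 1 / 2 * v i + C) (h : Tendsto (avg fun i => v (i + 1) - w i) atTop (𝓝 0)) :
    ∃ M, ∀ n, avg v n ≤ M := by
  obtain ⟨c, hc⟩ := h.bddAbove_range
  refine ⟨max 0 (2 * (v 0 + c + C)), fun n => ?_⟩
  rcases eq_or_ne n 0 with rfl | hn
  · simp [avg]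
  have hcn := hc ⟨n, rfl⟩
  have hwn := avg_mono hw n
  rw [avg_sub] at hcn
  rw [avg_add, avg_const_mul, avg_const hn] at hwn
  exact le_max_of_le_right (by linarith [avg_le_add_avg_succ hv n])

variable {Ω : Type*} {m0 : MeasurableSpace Ω} {μ : Measure Ω} {ℱ : Filtration ℕ m0}
  {θ θ₀ : Param} {N : ℕ → Ω → ℕ} {Λ : ℕ → Ω → ℝ≥0} {δ ρ B K l : ℝ} {p : ℝ≥0∞}

namespace PoissonModel

lemma measurable_traj (h : PoissonModel μ ℱ θ₀ N Λ) (θ : Param) (l : ℝ) (i : ℕ) :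
    Measurable[ℱ i] fun ω => traj θ l (fun j => N j ω) i := by
  induction i with
  | zero => exact measurable_const
  | succ i ih =>
    have hpair : Measurable fun p : ℕ × ℝ => intensity θ p.1 p.2 :=
      measurable_from_prod_countable_right fun y => (continuous_intensity θ y).measurable
    exact hpair.comp ((h.measurable_count i).prodMk (ih.mono (ℱ.mono i.le_succ) le_rfl))

variable [IsFiniteMeasure μ]

theorem ae_exists_rms_mean_le (h : PoissonModel μ ℱ θ₀ N Λ) (hb : CoefBounds δ ρ B θ₀)
    (hab : θ₀.a₂ + θ₀.b₂ < 1) (hK : ∀ᵐ ω ∂μ, Λ 0 ω ≤ K) :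
    ∀ᵐ ω ∂μ, ∃ M, ∀ n, rms (fun i => (Λ i ω : ℝ)) n ≤ M := by
  obtain ⟨u, hu, hdrift⟩ := hb.exists_hasExpDrift hab
  obtain ⟨C₁, hd₁⟩ := hdrift u hu le_rfl
  obtain ⟨C₂, hd₂⟩ := hdrift (u / 2) (half_pos hu) (half_le_self hu.le)
  have hL2 : LpBounded (fun i ω => Real.exp (u / 2 * Λ i ω)) 2 μ := by
    simpa using h.lpBounded_exp_div_mean hb hd₁ hK two_pos
  have hmeas (i : ℕ) : StronglyMeasurable[ℱ (i + 1)] fun ω => Real.exp (u / 2 * Λ (i + 1) ω) :=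
    (Real.measurable_exp.comp
      ((h.measurable_mean (i + 1)).coe_nnreal_real.const_mul _)).stronglyMeasurable
  have hcond (i : ℕ) := h.condExp_exp_succ_le hd₂ i ((hL2.memLp (i + 1)).integrable one_le_two)
  filter_upwards [hL2.succ.ae_tendsto_avg_sub_condExp hmeas, ae_all_iff.2 hcond] with ω hlln hω
  obtain ⟨M, hM⟩ := exists_avg_le_of_drift (v := fun i => Real.exp (u / 2 * Λ i ω))
    (fun i => (Real.exp_pos _).le) hω hlln
  refine ⟨√(2 * (u / 2)⁻¹ ^ 2 * M), fun n => Real.sqrt_le_sqrt ?_⟩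
  calc avg (fun i => (Λ i ω : ℝ) ^ 2) n
      ≤ avg (fun i => 2 * (u / 2)⁻¹ ^ 2 * Real.exp (u / 2 * Λ i ω)) n :=
        avg_mono (fun i => sq_le_mul_exp (half_pos hu) (Λ i ω).coe_nonneg) n
    _ ≤ 2 * (u / 2)⁻¹ ^ 2 * M := by
        rw [avg_const_mul]
        gcongr
        exact hM n

lemma ae_exists_rms_count_le (h : PoissonModel μ ℱ θ₀ N Λ) (hb : CoefBounds δ ρ B θ₀)
    (hab : θ₀.a₂ + θ₀.b₂ < 1) (hK : ∀ᵐ ω ∂μ, Λ 0 ω ≤ K) :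
    ∀ᵐ ω ∂μ, ∃ M, ∀ n, rms (fun i => (N i ω : ℝ)) n ≤ M := by
  filter_upwards [h.ae_exists_rms_mean_le hb hab hK, h.ae_count_le hb] with ω ⟨M, hM⟩ hcount
  have hδ : 0 < δ⁻¹ := inv_pos.2 hb.pos
  refine ⟨|δ⁻¹| * √(2 * M ^ 2), fun n => ?_⟩
  calc rms (fun i => (N i ω : ℝ)) n ≤ rms (fun i => δ⁻¹ * Λ (i + 1) ω) n :=
        rms_le_rms (fun i => abs_le_abs_of_nonneg (N i ω).cast_nonneg (hcount i)) n
    _ = |δ⁻¹| * rms (fun i => (Λ (i + 1) ω : ℝ)) n := rms_const_mul _ _ n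
    _ ≤ |δ⁻¹| * √(2 * M ^ 2) := by
        gcongr
        exact rms_succ_le hM n

lemma lpBounded_traj (h : PoissonModel μ ℱ θ₀ N Λ) (hb : CoefBounds δ ρ B θ)
    (hN : LpBounded (fun i ω => (N i ω : ℝ)) p μ) (hp : 1 ≤ p) (hl : 0 ≤ l) :
    LpBounded (fun i ω => traj θ l (fun j => N j ω) i) p μ := by
  have hinput := (hN.const_mul B).add (.const (fun _ => B) (memLp_const B)) hp
  refine .of_contraction (fun i => ((h.measurable_traj θ l i).mono (ℱ.le i) le_rfl)
    |>.aestronglyMeasurable) (memLp_const l) hinput hp hb.rho_pos.le hb.lt_one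
    fun i => ae_of_all _ fun ω => ?_
  have htraj := isTraj_traj θ l fun j => N j ω
  have hnonneg := htraj.nonneg hb hl
  rw [Real.norm_of_nonneg (hnonneg _), Real.norm_of_nonneg (hnonneg _)]
  refine (hb.intensity_le (N i ω) (hnonneg i)).trans ?_
  gcongr
  exact (le_abs_self _).trans_eq (by rw [Real.norm_eq_abs]; ring_nf)

lemma lpBounded_log_traj (h : PoissonModel μ ℱ θ₀ N Λ) (hb : CoefBounds δ ρ B θ)
    (hN : LpBounded (fun i ω => (N i ω : ℝ)) p μ) (hp : 1 ≤ p) (hl : 0 < l) :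
    LpBounded (fun i ω => Real.log (traj θ l (fun j => N j ω) i)) p μ := by
  set m := min δ l
  have hm : 0 < m := lt_min hb.pos hl
  refine ((LpBounded.const (fun _ => |Real.log m|) (memLp_const _)).add
    (h.lpBounded_traj hb hN hp hl.le) hp).mono (fun i => ((Real.measurable_log.comp
      (h.measurable_traj θ l i)).mono (ℱ.le i) le_rfl).aestronglyMeasurable)
    fun i => ae_of_all _ fun ω => ?_
  exact (abs_log_le_add hm ((isTraj_traj θ l _).le hb (min_le_left _ _) (min_le_right _ _)
    hl.le i)).trans (le_abs_self _)

lemma condExp_sub_mul_eq_zero (h : PoissonModel μ ℱ θ₀ N Λ) (i : ℕ) {f : Ω → ℝ}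
    (hf : Measurable[ℱ i] f) (hN : Integrable (fun ω => (N i ω : ℝ)) μ)
    (hΛ : Integrable (fun ω => (Λ i ω : ℝ)) μ)
    (hint : Integrable (fun ω => ((N i ω : ℝ) - Λ i ω) * f ω) μ) :
    μ[fun ω => ((N i ω : ℝ) - Λ i ω) * f ω | ℱ i] =ᵐ[μ] 0 := by
  have hmean : μ[fun ω => (Λ i ω : ℝ) | ℱ i] = fun ω => (Λ i ω : ℝ) :=
    condExp_of_stronglyMeasurable (ℱ.le i)
      (h.measurable_mean i).coe_nnreal_real.stronglyMeasurable hΛ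
  filter_upwards [condExp_mul_of_stronglyMeasurable_right hf.stronglyMeasurable hint (hN.sub hΛ),
    condExp_sub hN hΛ (ℱ i), (h.isCondPoisson i).condExp_natCast hN] with ω hmul hsub hcount
  refine hmul.trans ?_
  simp only [Pi.mul_apply, Pi.zero_apply]
  rw [show μ[fun ω => (N i ω : ℝ) - Λ i ω | ℱ i] ω = 0 from hsub.trans (by
    rw [Pi.sub_apply, hcount, hmean, sub_self]), zero_mul]

theorem ae_tendsto_noise (h : PoissonModel μ ℱ θ₀ N Λ) (hb₀ : CoefBounds δ ρ B θ₀)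
    (hab : θ₀.a₂ + θ₀.b₂ < 1) (hK : ∀ᵐ ω ∂μ, Λ 0 ω ≤ K) (hb : CoefBounds δ ρ B θ) (hl : 0 < l) :
    ∀ᵐ ω ∂μ, Tendsto (noise θ l (fun i => N i ω) (fun i => (Λ i ω : ℝ))) atTop (𝓝 0) := by
  obtain ⟨u, hu, hdrift⟩ := hb₀.exists_hasExpDrift hab
  obtain ⟨C, hd⟩ := hdrift u hu le_rfl
  have hN : LpBounded (fun i ω => (N i ω : ℝ)) 4 μ := by
    simpa using h.lpBounded_count hb₀ hd hK four_pos
  have hΛ : LpBounded (fun i ω => (Λ i ω : ℝ)) 4 μ := by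
    simpa using h.lpBounded_mean hb₀ hd hK four_pos
  have h4 : (1 : ℝ≥0∞) ≤ 4 := by norm_num
  have := holderTriple_four_four_two
  have hU : LpBounded (fun i ω => ((N i ω : ℝ) - Λ i ω) *
      Real.log (traj θ l (fun j => N j ω) i)) 2 μ := by
    simpa [sub_eq_add_neg] using
      (hN.add (hΛ.const_mul (-1)) h4).mul (h.lpBounded_log_traj hb hN h4 hl) (r := 2)
  have hlog (i : ℕ) : Measurable[ℱ i] fun ω => Real.log (traj θ l (fun j => N j ω) i) :=
    Real.measurable_log.comp (h.measurable_traj θ l i)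
  have hUm (i : ℕ) : StronglyMeasurable[ℱ (i + 1)] fun ω => ((N i ω : ℝ) - Λ i ω) *
      Real.log (traj θ l (fun j => N j ω) i) :=
    ((((measurable_of_countable fun k : ℕ => (k : ℝ)).comp (h.measurable_count i)).sub
      ((h.measurable_mean i).mono (ℱ.mono i.le_succ) le_rfl).coe_nnreal_real).mul
        ((hlog i).mono (ℱ.mono i.le_succ) le_rfl)).stronglyMeasurable
  have hcond (i : ℕ) := h.condExp_sub_mul_eq_zero i (hlog i) ((hN.memLp i).integrable h4)
    ((hΛ.memLp i).integrable h4) ((hU.memLp i).integrable one_le_two)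
  filter_upwards [hU.ae_tendsto_avg_sub_condExp hUm, ae_all_iff.2 hcond] with ω hlln hω
  simp only [hω, Pi.zero_apply, sub_zero] at hlln
  exact hlln

end PoissonModel

end PathwiseBounds

section Frequencies

lemma HasPosLowerDensity.of_tendsto_avg_sub {A A' : Set ℕ} {q : ℕ → ℝ} {c : ℝ} (hc : 0 < c)
    (hA : HasPosLowerDensity A) (hq : ∀ i, c * A.indicator 1 i ≤ q i)
    (h : Tendsto (avg fun i => A'.indicator 1 i - q i) atTop (𝓝 0)) : HasPosLowerDensity A' := by
  obtain ⟨a, ha, hfreq⟩ := hA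
  have hca : 0 < c * a := mul_pos hc ha
  refine ⟨c * a / 2, half_pos hca, ?_⟩
  filter_upwards [hfreq, h.eventually (lt_mem_nhds (neg_lt_zero.2 (half_pos hca)))] with n hn hlt
  have hqn := avg_mono hq n
  rw [avg_const_mul] at hqn
  rw [avg_sub] at hlt
  linarith [mul_le_mul_of_nonneg_left hn hc.le]

lemma hasPosLowerDensity_setOf_mem_Icc {x : ℕ → ℝ} {δ M : ℝ} (hδ : ∀ i, δ ≤ x (i + 1))
    (hM : ∀ n, rms x n ≤ M) : ∃ K : ℕ, HasPosLowerDensity {i | x i ∈ Set.Icc δ K} := by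
  obtain ⟨K, hK⟩ := exists_nat_gt (√(2 * M ^ 2))
  have hsq (n : ℕ) : avg (fun i => x (i + 1) ^ 2) n ≤ √(2 * M ^ 2) ^ 2 := by
    rw [← sq_rms]
    exact pow_le_pow_left₀ (rms_nonneg _ _) (rms_succ_le hM n) 2
  have hdense := hasPosLowerDensity_setOf_le (fun i => sq_nonneg (x (i + 1))) hsq
    (pow_lt_pow_left₀ hK (Real.sqrt_nonneg _) two_ne_zero)
  refine ⟨K, hdense.image_succ.mono ?_⟩
  rintro _ ⟨i, hi, rfl⟩
  exact ⟨hδ i, le_of_sq_le_sq hi K.cast_nonneg⟩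

variable {Ω : Type*} {m0 : MeasurableSpace Ω} {μ : Measure Ω} [IsFiniteMeasure μ]
  {ℱ : Filtration ℕ m0} {θ₀ : Param} {N : ℕ → Ω → ℕ} {Λ : ℕ → Ω → ℝ≥0} {δ ρ B m K : ℝ}

lemma IsCondPoisson.condExp_indicator_inter {m : MeasurableSpace Ω} {X : Ω → ℕ} {r : Ω → ℝ≥0}
    (h : IsCondPoisson μ m X r) {A : Set Ω} (hA : MeasurableSet[m] A) (k : ℕ) :
    μ[(A ∩ X ⁻¹' {k}).indicator (fun _ => (1 : ℝ)) | m]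
      =ᵐ[μ] A.indicator fun ω => (poissonMeasure (r ω)).real {k} := by
  rw [← Set.indicator_indicator]
  refine (MeasureTheory.condExp_indicator ((integrable_const _).indicator
    (h.measurable (measurableSet_singleton k))) hA).trans ?_
  filter_upwards [h.condExp_indicator k] with ω hω
  simp only [Set.indicator, hω]

namespace PoissonModel

theorem ae_hasPosLowerDensity_inter (h : PoissonModel μ ℱ θ₀ N Λ) {A : ℕ → Set Ω}
    (hA : ∀ i, MeasurableSet[ℱ i] (A i)) (hm : 0 < m)
    (hmK : ∀ᵐ ω ∂μ, ∀ i, ω ∈ A i → (Λ i ω : ℝ) ∈ Set.Icc m K) (y : ℕ) :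
    ∀ᵐ ω ∂μ, HasPosLowerDensity {i | ω ∈ A i} →
      HasPosLowerDensity {i | ω ∈ A i ∧ N i ω = y} := by
  obtain ⟨c, hc, hle⟩ := exists_le_poissonMeasure_real_singleton y hm K
  have hmeas (i : ℕ) : StronglyMeasurable[ℱ (i + 1)]
      ((A i ∩ N i ⁻¹' {y}).indicator fun _ => (1 : ℝ)) :=
    stronglyMeasurable_const.indicator ((ℱ.mono i.le_succ _ (hA i)).inter
      (h.measurable_count i (measurableSet_singleton y)))
  have hL2 : LpBounded (fun i => (A i ∩ N i ⁻¹' {y}).indicator fun _ => (1 : ℝ)) 2 μ := by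
    refine (LpBounded.const (fun _ => (1 : ℝ)) (memLp_const _)).mono
      (fun i => ((hmeas i).mono (ℱ.le _)).aestronglyMeasurable) fun i => ae_of_all _ fun ω => ?_
    exact norm_indicator_le_norm_self _ _
  have hcond (i : ℕ) := (h.isCondPoisson i).condExp_indicator_inter (hA i) y
  filter_upwards [hmK, hL2.ae_tendsto_avg_sub_condExp hmeas, ae_all_iff.2 hcond]
    with ω hmK hlln hω hdense
  simp only [hω] at hlln
  refine hdense.of_tendsto_avg_sub hc (fun i => ?_) hlln
  by_cases hi : ω ∈ A i
  · simpa [hi] using hle _ (hmK i hi).1 (hmK i hi).2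
  · simp [hi]

lemma ae_hasPosLowerDensity_succ_inter (h : PoissonModel μ ℱ θ₀ N Λ)
    (hb : CoefBounds δ ρ B θ₀) (K : ℝ) (y' y : ℕ) :
    ∀ᵐ ω ∂μ, HasPosLowerDensity {i | (Λ i ω : ℝ) ∈ Set.Icc δ K ∧ N i ω = y'} →
      HasPosLowerDensity
        (Nat.succ '' {i | (Λ i ω : ℝ) ∈ Set.Icc δ K ∧ N i ω = y'} ∩ {j | N j ω = y}) := by
  have hmeas (j : ℕ) : MeasurableSet[ℱ j]
      {ω | j ∈ Nat.succ '' {i | (Λ i ω : ℝ) ∈ Set.Icc δ K ∧ N i ω = y'}} := by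
    cases j with
    | zero => simp
    | succ i =>
      simp only [Nat.succ_eq_add_one, Set.mem_image, Set.mem_ofPred_eq, add_left_inj,
        exists_eq_right]
      exact ((ℱ.mono i.le_succ _ ((h.measurable_mean i).coe_nnreal_real measurableSet_Icc))).inter
        (h.measurable_count i (measurableSet_singleton y'))
  have hnext : ∀ᵐ ω ∂μ, ∀ j,
      ω ∈ {ω | j ∈ Nat.succ '' {i | (Λ i ω : ℝ) ∈ Set.Icc δ K ∧ N i ω = y'}} →
        (Λ j ω : ℝ) ∈ Set.Icc δ (ρ * K + B * (1 + y')) := by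
    filter_upwards [h.ae_mean_succ] with ω hω
    rintro _ ⟨i, ⟨hi, rfl⟩, rfl⟩
    rw [Nat.succ_eq_add_one, hω i]
    refine ⟨hb.delta_le_intensity _ (Λ i ω).coe_nonneg,
      (hb.intensity_le _ (Λ i ω).coe_nonneg).trans ?_⟩
    gcongr
    exacts [hb.rho_pos.le, hi.2]
  filter_upwards [h.ae_hasPosLowerDensity_inter hmeas hb.pos hnext y] with ω hω hdense
  exact hω hdense.image_succ

theorem ae_hasPosLowerDensity_pattern (h : PoissonModel μ ℱ θ₀ N Λ) (hb : CoefBounds δ ρ B θ₀)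
    (hM : ∀ᵐ ω ∂μ, ∃ M, ∀ n, rms (fun i => (Λ i ω : ℝ)) n ≤ M) :
    ∀ᵐ ω ∂μ, ∃ K : ℝ, ∀ y' y, HasPosLowerDensity
      (Nat.succ '' {i | Λ i ω ≤ K ∧ N i ω = y'} ∩ {j | N j ω = y}) := by
  have hfirst : ∀ᵐ ω ∂μ, ∀ K y' : ℕ, HasPosLowerDensity {i | (Λ i ω : ℝ) ∈ Set.Icc δ K} →
      HasPosLowerDensity {i | (Λ i ω : ℝ) ∈ Set.Icc δ K ∧ N i ω = y'} :=
    ae_all_iff.2 fun K => ae_all_iff.2 fun y' => h.ae_hasPosLowerDensity_inter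
      (fun i => (h.measurable_mean i).coe_nnreal_real measurableSet_Icc) hb.pos
      (ae_of_all _ fun _ _ hω => hω) y'
  have hsecond := ae_all_iff.2 fun K : ℕ => ae_all_iff.2 fun y' => ae_all_iff.2 fun y =>
    h.ae_hasPosLowerDensity_succ_inter hb K y' y
  filter_upwards [hfirst, hsecond, hM, h.ae_mean_succ] with ω hfirst hsecond ⟨M, hM⟩ hmean
  obtain ⟨K, hK⟩ := hasPosLowerDensity_setOf_mem_Icc (δ := δ) (fun i => by
    rw [hmean i]; exact hb.delta_le_intensity _ (Λ i ω).coe_nonneg) hM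
  refine ⟨K, fun y' y => (hsecond K y' y (hfirst K y' hK)).mono ?_⟩
  gcongr with i
  exact fun hi => hi.2

end PoissonModel

end Frequencies

section Convergence

/-- The set of all coefficient vectors with strictly positive entries for which both regimes of the
recursion are contractions in the intensity, `a₁ < 1` and `a₂ < 1`. -/
def contractive : Set Coef := {x | (∀ i, 0 < x i) ∧ x 1 < 1 ∧ x 4 < 1}

lemma bigTheta_subset_contractive : bigTheta ⊆ contractive :=
  fun x hx => ⟨hx.1, hx.2.1, by linarith [hx.1 5, hx.2.2.2]⟩

lemma exists_coefBounds {D : Set Coef} (hD : IsCompact D) (hDc : D ⊆ contractive) :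
    ∃ δ ρ B, ∀ θ : Param, θ.2 ∈ D → CoefBounds δ ρ B θ := by
  rcases D.eq_empty_or_nonempty with rfl | hne
  · exact ⟨0, 0, 0, fun θ hθ => hθ.elim⟩
  have hcont (i : Fin 6) : ContinuousOn (fun x : Coef => x i) D := by fun_prop
  choose xm hxm hmin using fun i => hD.exists_isMinOn hne (hcont i)
  choose xM hxM hmax using fun i => hD.exists_isMaxOn hne (hcont i)
  refine ⟨Finset.univ.inf' Finset.univ_nonempty fun i => xm i i, max (xM 1 1) (xM 4 4),
    Finset.univ.sup' Finset.univ_nonempty fun i => xM i i, fun θ hθ => ?_⟩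
  exact {
    pos := (Finset.lt_inf'_iff _).2 fun i _ => (hDc (hxm i)).1 i
    lt_one := max_lt (hDc (hxM 1)).2.1 (hDc (hxM 4)).2.2
    le_coef := fun i => (Finset.inf'_le _ (Finset.mem_univ i)).trans (hmin i hθ)
    coef_le := fun i => (hmax i hθ).trans (Finset.le_sup' (fun i => xM i i) (Finset.mem_univ i))
    a₁_le := (hmax 1 hθ).trans (le_max_left _ _)
    a₂_le := (hmax 4 hθ).trans (le_max_right _ _) }

lemma isCompact_paramSpace (rstar : ℕ) {D : Set Coef} (hD : IsCompact D) :
    IsCompact (paramSpace rstar D) :=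
  (Set.finite_Iic rstar).isCompact.prod hD

variable {Ω : Type*} {m0 : MeasurableSpace Ω} {μ : Measure Ω} [IsFiniteMeasure μ]
  {ℱ : Filtration ℕ m0} {θ₀ : Param} {N : ℕ → Ω → ℕ} {Λ : ℕ → Ω → ℝ≥0} {δ ρ B K l : ℝ}
  {S : Set Param}

lemma IsCondPoisson.restrict {m : MeasurableSpace Ω} {X : Ω → ℕ} {r : Ω → ℝ≥0}
    (h : IsCondPoisson μ m X r) {A : Set Ω} (hA : MeasurableSet[m] A) :
    IsCondPoisson (μ.restrict A) m X r where
  le := h.le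
  measurable := h.measurable
  measurable_mean := h.measurable_mean
  condExp_indicator k := (condExp_restrict_ae_eq_restrict h.le hA ((integrable_const _).indicator
    (h.measurable (measurableSet_singleton k)))).trans (ae_restrict_of_ae (h.condExp_indicator k))

namespace PoissonModel

lemma restrict (h : PoissonModel μ ℱ θ₀ N Λ) {A : Set Ω} (hA : MeasurableSet[ℱ 0] A) :
    PoissonModel (μ.restrict A) ℱ θ₀ N Λ where
  measurable_count := h.measurable_count
  isCondPoisson i := (h.isCondPoisson i).restrict (ℱ.mono (Nat.zero_le i) A hA)
  isTraj := ae_restrict_of_ae h.isTraj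

lemma ae_isTypicalPath_of_bounded (h : PoissonModel μ ℱ θ₀ N Λ)
    (hab : θ₀.a₂ + θ₀.b₂ < 1) (hK : ∀ᵐ ω ∂μ, Λ 0 ω ≤ K) (hScpt : IsCompact S)
    (hS : ∀ θ ∈ S, CoefBounds δ ρ B θ) (hθ₀ : θ₀ ∈ S) (hl : 0 < l) :
    ∀ᵐ ω ∂μ, IsTypicalPath S l θ₀ (fun i => N i ω) (fun i => (Λ i ω : ℝ)) := by
  have hb := hS θ₀ hθ₀
  obtain ⟨Q, hQS, hQc, hSQ⟩ := hScpt.isSeparable.exists_countable_dense_subset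
  have hnoise := (ae_ball_iff hQc).2 fun θ hθ =>
    h.ae_tendsto_noise hb hab hK (hS θ (hQS hθ)) hl
  have hmean := h.ae_exists_rms_mean_le hb hab hK
  filter_upwards [h.isTraj, hnoise, hmean, h.ae_exists_rms_count_le hb hab hK,
    h.ae_hasPosLowerDensity_pattern hb hmean] with ω htraj hnoise ⟨C', hC'⟩ ⟨C, hC⟩ ⟨K', hK'⟩
  exact {
    isTraj := htraj
    nonneg_zero := (Λ 0 ω).coe_nonneg
    exists_rms_le := ⟨C, hC⟩
    tendsto_noise := tendsto_noise_of_dense hS hb.pos hl hC hC' hQS hSQ hnoise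
    pattern := fun y' y => ⟨K', hK' y' y⟩ }

theorem ae_isTypicalPath (h : PoissonModel μ ℱ θ₀ N Λ) (hab : θ₀.a₂ + θ₀.b₂ < 1)
    (hScpt : IsCompact S) (hS : ∀ θ ∈ S, CoefBounds δ ρ B θ) (hθ₀ : θ₀ ∈ S) (hl : 0 < l) :
    ∀ᵐ ω ∂μ, IsTypicalPath S l θ₀ (fun i => N i ω) (fun i => (Λ i ω : ℝ)) := by
  have hmeas (K : ℕ) : MeasurableSet[ℱ 0] {ω | (Λ 0 ω : ℝ) ≤ K} :=
    (h.measurable_mean 0).coe_nnreal_real measurableSet_Iic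
  have hbdd : ∀ᵐ ω ∂μ, ∀ K : ℕ, (Λ 0 ω : ℝ) ≤ K →
      IsTypicalPath S l θ₀ (fun i => N i ω) (fun i => (Λ i ω : ℝ)) := by
    refine ae_all_iff.2 fun K => ?_
    have hms := ℱ.le 0 _ (hmeas K)
    exact (ae_restrict_iff' hms).1 ((h.restrict (hmeas K)).ae_isTypicalPath_of_bounded hab
      (ae_restrict_mem hms) hScpt hS hθ₀ hl)
  filter_upwards [hbdd] with ω hω
  exact (exists_nat_ge (Λ 0 ω : ℝ)).elim hω

end PoissonModel

end Convergence

section CountingModel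

variable {Ω : Type*} [m0 : MeasurableSpace Ω] {P : Measure Ω} {θ₀ : Param} {Y : ℤ → Ω → ℕ}
  {lam : ℤ → Ω → ℝ≥0}

/-- A version of the intensity `λ_t` which is measurable with respect to `F_{t-1}`: a
Poisson variable with mean `r` vanishes with probability `e^{-r}`. -/
def predictableMean (P : Measure Ω) (Y : ℤ → Ω → ℕ) (t : ℤ) (ω : Ω) : ℝ≥0 :=
  Real.toNNReal (-Real.log (P[(Y t ⁻¹' {0}).indicator (fun _ => (1 : ℝ)) | past Y (t - 1)] ω))

lemma measurable_predictableMean (P : Measure Ω) (Y : ℤ → Ω → ℕ) (t : ℤ) :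
    Measurable[past Y (t - 1)] (predictableMean P Y t) :=
  (Real.measurable_log.comp stronglyMeasurable_condExp.measurable).neg.real_toNNReal

namespace IsSETPAR

/-- The filtration `F_0 ⊆ F_1 ⊆ …` of the counts, started at time `0`. -/
def filtration (hY : IsSETPAR P θ₀ Y lam) : Filtration ℕ m0 where
  seq i := past Y i
  mono' i j hij := iSup_le fun s => le_iSup_of_le
    (⟨s.1, s.2.trans (by exact_mod_cast hij)⟩ : {s : ℤ // s ≤ (j : ℤ)}) le_rfl
  le' _ := iSup_le fun s => (hY.measurable s.1).comap_le

lemma predictableMean_ae_eq (hY : IsSETPAR P θ₀ Y lam) (t : ℤ) :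
    predictableMean P Y t =ᵐ[P] lam t := by
  filter_upwards [hY.condLaw t {0}] with ω hω
  rw [predictableMean, hω, poissonMeasure_real_singleton]
  simp

theorem poissonModel (hY : IsSETPAR P θ₀ Y lam) :
    PoissonModel P hY.filtration θ₀ (fun i => Y (i + 1))
      (fun i => predictableMean P Y (i + 1)) where
  measurable_count i := Measurable.of_comap_le (le_iSup_of_le
    (⟨((i + 1 : ℕ) : ℤ), le_rfl⟩ : {s : ℤ // s ≤ ((i + 1 : ℕ) : ℤ)}) le_rfl)
  isCondPoisson i := {
    le := hY.filtration.le i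
    measurable := hY.measurable _
    measurable_mean := by
      have hmeas := measurable_predictableMean P Y (i + 1)
      rwa [add_sub_cancel_right] at hmeas
    condExp_indicator := fun k => by
      have hlaw := hY.condLaw (i + 1) {k}
      rw [add_sub_cancel_right] at hlaw
      filter_upwards [hlaw, hY.predictableMean_ae_eq (i + 1)] with ω hω hmean
      rw [hmean]
      exact hω }
  isTraj := by
    filter_upwards [ae_all_iff.2 hY.recursion, ae_all_iff.2 hY.predictableMean_ae_eq]
      with ω hω hmean i
    simp only [hmean]
    simpa using hω (i + 1 + 1)

end IsSETPAR

end CountingModel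

end SETPAR

end

theorem theorem2_general {Ω : Type*} [MeasurableSpace Ω] (P : Measure Ω) [IsFiniteMeasure P]
    (rstar : ℕ) (D : Set SETPAR.Coef) (hD : IsCompact D) (hDc : D ⊆ SETPAR.contractive)
    (θ₀ : SETPAR.Param) (hθ₀ : θ₀ ∈ SETPAR.paramSpace rstar D) (hab : θ₀.a₂ + θ₀.b₂ < 1)
    (Y : ℤ → Ω → ℕ) (lam : ℤ → Ω → ℝ≥0) (hY : SETPAR.IsSETPAR P θ₀ Y lam)
    (l₁ : ℝ) (hl₁ : 0 < l₁) (θhat : ℕ → Ω → SETPAR.Param)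
    (hθhat : ∀ n : ℕ, 1 ≤ n → ∀ᵐ ω ∂P,
      SETPAR.IsMLE (SETPAR.paramSpace rstar D) l₁ (fun t : ℕ => Y (t : ℤ) ω) n (θhat n ω)) :
    (SETPAR.Nondegenerate rstar θ₀ →
      ∀ᵐ ω ∂P, Tendsto (fun n => θhat n ω) atTop (𝓝 θ₀) ∧
        ∀ᶠ n in atTop, (θhat n ω).1 = θ₀.1) ∧
    (∀ᵐ ω ∂P, Tendsto
      (fun n => Metric.infDist (θhat n ω)
        (SETPAR.sameModel (SETPAR.paramSpace rstar D) θ₀)) atTop (𝓝 0)) := by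
  obtain ⟨δ, ρ, B, hbounds⟩ := SETPAR.exists_coefBounds hD hDc
  have hS : ∀ θ ∈ SETPAR.paramSpace rstar D, SETPAR.CoefBounds δ ρ B θ :=
    fun θ hθ => hbounds θ hθ.2
  have hScpt := SETPAR.isCompact_paramSpace rstar hD
  have hset : ∀ᵐ ω ∂P, Tendsto (fun n => Metric.infDist (θhat n ω)
      (SETPAR.sameModel (SETPAR.paramSpace rstar D) θ₀)) atTop (𝓝 0) := by
    filter_upwards [hY.poissonModel.ae_isTypicalPath hab hScpt hS hθ₀ hl₁,
      ae_all_iff.2 fun n => ae_all_iff.2 (hθhat n)] with ω hpath hmle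
    exact hpath.tendsto_infDist_sameModel hScpt hS hθ₀ hl₁
      (Y := fun t : ℕ => Y t ω) (fun _ => rfl) ((eventually_ge_atTop 1).mono hmle)
  refine ⟨fun hnd => ?_, hset⟩
  simp only [hnd.sameModel_eq_singleton hθ₀, Metric.infDist_singleton] at hset
  filter_upwards [hset] with ω hω
  refine ⟨tendsto_iff_dist_tendsto_zero.2 hω, ?_⟩
  filter_upwards [hω.eventually (gt_mem_nhds one_pos)] with n hn
  exact SETPAR.Param.fst_eq_of_dist_lt_one hn

theorem theorem2 {Ω : Type*} [MeasurableSpace Ω] (P : Measure Ω) [IsProbabilityMeasure P]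
    (rstar : ℕ) (D : Set SETPAR.Coef) (hD : IsCompact D) (hDΘ : D ⊆ SETPAR.bigTheta)
    (θ₀ : SETPAR.Param) (hr₀ : θ₀.1 ≤ rstar) (hθ₀ : θ₀.2 ∈ interior D)
    (Y : ℤ → Ω → ℕ) (lam : ℤ → Ω → ℝ≥0) (hY : SETPAR.IsSETPAR P θ₀ Y lam)
    (l₁ : ℝ) (hl₁ : 0 < l₁)
    (θhat : ℕ → Ω → SETPAR.Param)
    (hθhat : ∀ n : ℕ, 1 ≤ n → ∀ᵐ ω ∂P,
      SETPAR.IsMLE (SETPAR.paramSpace rstar D) l₁ (fun t : ℕ => Y (t : ℤ) ω) n (θhat n ω)) :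
    (SETPAR.Nondegenerate rstar θ₀ →
      ∀ᵐ ω ∂P, Tendsto (fun n => θhat n ω) atTop (𝓝 θ₀) ∧
        ∀ᶠ n in atTop, (θhat n ω).1 = θ₀.1) ∧
    (∀ᵐ ω ∂P, Tendsto
      (fun n => Metric.infDist (θhat n ω)
        (SETPAR.sameModel (SETPAR.paramSpace rstar D) θ₀)) atTop (𝓝 0)) :=
  theorem2_general P rstar D hD (hDΘ.trans SETPAR.bigTheta_subset_contractive) θ₀
    ⟨hr₀, interior_subset hθ₀⟩ (hDΘ (interior_subset hθ₀)).2.2.2 Y lam hY l₁ hl₁ θhat hθhat
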